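/- **Fundamental solutions on higher-dimensional Möbius strips and Klein bottles.** Let $n\ge 2$, $\epsilon>0$, $\mathbf k=\frac{\epsilon+i}{\epsilon^2+1}$, let $\mathbb C_n=\mathbb C\otimes C\ell_{0,n}$ be the complexified Clifford algebra, and for $(x,t)\in\mathbb R^n\times\mathbb R$ let $$e_-^{\epsilon}(x,t)=(i-\epsilon)\,\frac{H(t)}{(4\pi(\epsilon-i)t)^{n/2}}\exp\Big(-\frac{(\epsilon+i)|x|^2}{4(\epsilon^2+1)t}\Big)$$ (principal branch; $e_-^\epsilon=0$ for $t\le 0$), the fundamental solution of $\Delta-\mathbf k\partial_t$ on $\mathbb R^n\times\mathbb R$. For $\sigma=\pm1$ put $R_\sigma x=(x_1,\dots,x_{n-1},\sigma x_n)$. Consider a lattice $\{\omega(m):m\in\mathbb Z^d\}\subset\mathbb R^n$, signs $s(m)=\pm1$, a set $S\subseteq\{1,\dots,d\}$ and $\chi(m)=(-1)^{\sum_{i\in S}m_i}$. Let $M=\mathbb R^n/\!\sim$, where $\sim$ is the equivalence relation generated by $z+\omega(m)\sim R_{s(m)}z$ ($z\in\mathbb R^n$), and let $B$ be the pin bundle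 over $M$ obtained from $\mathbb R^n\times\mathbb C_n$ by the identifications $(z+\omega(m),X)\sim(R_{s(m)}z,\chi(m)X)$. (For $S=\{1,\dots,l\}$ the factor is $(-1)^{m_1+\cdots+m_l}$; $S=\emptyset$ is the trivial pin bundle.) Put $$P(x,t)=\sum_{m\in\mathbb Z^d}\chi(m)\,e_-^{\epsilon}\big(R_{s(m)}x+\omega(m),t\big).$$ *Möbius strips.* Let $1\le k\le n-1$, let $v_1,\dots,v_k$ be a basis of $\mathbb R^k\subset\mathbb R^n$ (first $k$ coordinates), $\Omega_k=\bigoplus\mathbb Z v_i$, $d=k$, $\omega(m)=\sum m_iv_i$, and let $s$ be either - (M1) $s(m)=\mathrm{sgn}(\omega(m))$, which is $1$ if $\omega(m)\in2\Omega_k$ and $-1$ otherwise, or - (M2) $s(m)=(-1)^{m_1+\cdots+m_k}$. The two rules coincide for $k=1$. *Klein bottles.* Let $v_1,\dots,v_{n-1}$ be a basis of $\mathbb R^{n-1}\subset\mathbb R^n$, $d=n$, $\omega(m)=\sum_{i<n}m_iv_i+m_ne_n$, and let $s$ be either - (K1) $s(m)=(-1)^{m_n}$, or - (K2) $s(m)=(-1)^{m_1+\cdots+m_{n-1}}$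 (for $n=2$ this is the classical Klein bottle). Then, in all these cases and for every $S$: 1. The series $P$ converges normally on every compact subset of $\mathbb R^n\times\mathbb R$ that contains no point $(\omega(m),0)$. 2. Each term of the series and $P$ itself are smooth for $t>0$ and satisfy $(\Delta-\mathbf k\partial_t)u=0$ there. 3. $P(R_{s(m)}z,t)=\chi(m)P(z+\omega(m),t)$ for all $m,z,t$, and $[x]\mapsto[x,P(x,t)]$ is a well-defined section of $B$ over $M\times\mathbb R^+$. 4. $P$ is locally integrable on $\mathbb R^n\times\mathbb R$, and $(\Delta-\mathbf k\partial_t)P=\sum_m\chi(m)\,\delta_{(\omega(m),0)}$ as distributions on $\mathbb R^n\times\mathbb R$. The right-hand side is the pull-back of the Dirac section at the class of the origin. Moreover, in the cases (M1) with $k=1$, (M2), (K1) and (K2), the section is the fundamental solution on the quotient with pole at the class of the origin. That is, almost-everywhere fundamental domains for $\sim$ exist, and for every such measurable $F\subset\mathbb R^n$ and every smooth compactly supported section $\varphi$ of $B$ over $M\times\mathbb R$ (regarded as a $\mathbb C_n$-valued function on $\mathbb R^n\times\mathbb R$ with $\varphi(R_{s(m)}z,t)=\chi(m)\varphi(z+\omega(m),t)$),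 $$\int_{F\times\mathbb R}P\,(\Delta+\mathbf k\partial_t)\varphi\;dx\,dt=\varphi(0,0),$$ with an absolutely convergent integral. -/

import Mathlib

open scoped ContDiff TensorProduct
open MeasureTheory

noncomputable section

namespace PinQuotient

/-- Euclidean space `ℝⁿ`. -/
abbrev E (n : ℕ) : Type := EuclideanSpace ℝ (Fin n)

/-- Space-time `ℝⁿ × ℝ`. -/
abbrev SpaceTime (n : ℕ) : Type := E n × ℝ

/-- The complexified Clifford algebra `ℂ ⊗ Cl₀,ₙ` with `eᵢ eⱼ + eⱼ eᵢ = -2 δᵢⱼ`. -/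
abbrev CliffordC (n : ℕ) : Type :=
  ℂ ⊗[ℝ] CliffordAlgebra (QuadraticMap.weightedSumSquares ℝ (fun _ : Fin n => (-1 : ℝ)))

/-! ### The regularized Schrödinger operator and its Euclidean fundamental solution -/

/-- The regularization parameter `𝐤 = (ε + i) / (ε² + 1)`. -/
def kReg (ε : ℝ) : ℂ := ((ε : ℂ) + Complex.I) / ((ε : ℂ) ^ 2 + 1)

/-- The regularized Schrödinger operator `Δ - 𝐤 ∂ₜ`. -/
def schrodingerOp (ε : ℝ) {n : ℕ} (f : SpaceTime n → ℂ) (p : SpaceTime n) : ℂ :=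
  Laplacian.laplacian (fun y : E n => f (y, p.2)) p.1 - kReg ε * deriv (fun τ : ℝ => f (p.1, τ)) p.2

/-- The formal transpose `Δ + 𝐤 ∂ₜ` of `Δ - 𝐤 ∂ₜ`. -/
def schrodingerOpTranspose (ε : ℝ) {n : ℕ} (f : SpaceTime n → ℂ) (p : SpaceTime n) : ℂ :=
  Laplacian.laplacian (fun y : E n => f (y, p.2)) p.1 + kReg ε * deriv (fun τ : ℝ => f (p.1, τ)) p.2

/-- The kernel `e₋^ε(x, t) = (i - ε) H(t) (4π(ε - i)t)^{-n/2} exp(-(ε + i)|x|² / (4(ε² + 1)t))`,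
with the principal branch of the power. -/
def eMinus (ε : ℝ) {n : ℕ} (p : SpaceTime n) : ℂ :=
  if 0 < p.2 then
    (Complex.I - (ε : ℂ)) /
        (4 * (Real.pi : ℂ) * ((ε : ℂ) - Complex.I) * (p.2 : ℂ)) ^ ((n : ℂ) / 2) *
      Complex.exp
        (-(((ε : ℂ) + Complex.I) * ((‖p.1‖ ^ 2 : ℝ) : ℂ)) / (4 * ((ε : ℂ) ^ 2 + 1) * (p.2 : ℂ)))
  else 0

/-! ### Lattices, sign rules and reflections -/

/-- The lattice vector `m₁ v₁ + ⋯ + m_k v_k`. -/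
def latticeVec {k : ℕ} (v : Fin k → E k) (m : Fin k → ℤ) : E k := ∑ i, m i • v i

/-- `ℝᵏ` as the space of the first `k` coordinates of `ℝⁿ`. -/
def zeroExtend {k : ℕ} (n : ℕ) (y : E k) : E n :=
  WithLp.toLp 2 (fun i : Fin n => if h : (i : ℕ) < k then y ⟨i, h⟩ else 0)

/-- `(x₁, …, x_{n-1}, x_n) ↦ (x₁, …, x_{n-1}, σ x_n)`, with `n = N + 1`. -/
def reflLast {N : ℕ} (σ : ℤˣ) (x : E (N + 1)) : E (N + 1) :=
  WithLp.toLp 2 (fun i => if i = Fin.last N then (((σ : ℤ) : ℝ)) * x i else x i)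

/-- The sign of `v ∈ Ω = ℤ v₁ + ⋯ + ℤ v_k`: `1` if `v ∈ 2 Ω` and `-1` if `v ∈ Ω \ 2 Ω`. -/
def latticeSgn {k : ℕ} (v : Fin k → E k) (m : Fin k → ℤ) : ℤˣ :=
  open Classical in
  if ∃ m' : Fin k → ℤ, latticeVec v m = (2 : ℤ) • latticeVec v m' then 1 else -1

/-- The parity factor `(-1)^(∑_{i ∈ S} mᵢ)` of the pin bundle with anti-periodic directions `S`;
`S = {1, …, l}` gives `(-1)^(m₁ + ⋯ + m_l)`, and `S = ∅` the trivial bundle. -/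
def paritySign {d : ℕ} (S : Finset (Fin d)) (m : Fin d → ℤ) : ℤˣ := (-1 : ℤˣ) ^ (∑ i ∈ S, m i)

/-- The lattice `Ω_k ⊂ ℝᵏ ⊂ ℝⁿ` acting on the Möbius strip. -/
def moebiusLat (N : ℕ) {k : ℕ} (v : Fin k → E k) (m : Fin k → ℤ) : E (N + 1) :=
  zeroExtend (N + 1) (latticeVec v m)

/-- The lattice `Ω_{n-1} + ℤ eₙ ⊂ ℝⁿ` acting on the Klein bottle, with `n = N + 1`. -/
def kleinLat {N : ℕ} (v : Fin N → E N) (m : Fin (N + 1) → ℤ) : E (N + 1) :=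
  zeroExtend (N + 1) (latticeVec v (fun i => m i.castSucc)) +
    m (Fin.last N) • EuclideanSpace.single (Fin.last N) (1 : ℝ)

/-! ### Quotients and bundles

The data are a parametrized lattice `lat`, a sign rule `s` for the reflection of the last
coordinate and a sign rule `χ` for the fibre. -/

section Quotients

variable {N d : ℕ} (lat : (Fin d → ℤ) → E (N + 1)) (s χ : (Fin d → ℤ) → ℤˣ)

/-- The identification `z + lat m ↦ (z₁, …, z_{n-1}, s(m) zₙ)` of points of `ℝⁿ`. -/
def BaseRel (p q : E (N + 1)) : Prop :=
  ∃ (m : Fin d → ℤ) (z : E (N + 1)), p = z + lat m ∧ q = reflLast (s m) z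

/-- The quotient of `ℝⁿ` by the equivalence relation generated by `BaseRel`. -/
abbrev Base : Type := Quot (BaseRel lat s)

/-- The identification `(z + lat m, X) ↦ ((z₁, …, z_{n-1}, s(m) zₙ), χ(m) X)` of points of
`ℝⁿ × ℂₙ`. -/
def BundleRel (p q : E (N + 1) × CliffordC (N + 1)) : Prop :=
  ∃ (m : Fin d → ℤ) (z : E (N + 1)), p.1 = z + lat m ∧ q.1 = reflLast (s m) z ∧
    q.2 = (((χ m : ℤˣ) : ℤ) : ℂ) • p.2

/-- The total space of the pin bundle. -/
abbrev Bundle : Type := Quot (BundleRel lat s χ)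

/-- The bundle projection. -/
def bundleProj : Bundle lat s χ → Base lat s :=
  Quot.map Prod.fst (fun _ _ ⟨m, z, h₁, h₂, _⟩ => ⟨m, z, h₁, h₂⟩)

/-- The term `χ(m) e₋^ε((x₁, …, x_{n-1}, s(m) xₙ) + lat m, t)`. -/
def seriesTerm (ε : ℝ) (m : Fin d → ℤ) (p : SpaceTime (N + 1)) : ℂ :=
  (((χ m : ℤˣ) : ℤ) : ℂ) * eMinus ε (reflLast (s m) p.1 + lat m, p.2)

/-- The sign-twisted periodization of `e₋^ε`. -/
def twistedSeries (ε : ℝ) (p : SpaceTime (N + 1)) : ℂ := ∑' m, seriesTerm lat s χ ε m p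

/-- Convergence and descent of the periodization, and the equation
`(Δ - 𝐤 ∂ₜ) P = ∑ₘ χ(m) δ_(lat m, 0)` for it on `ℝⁿ × ℝ`, whose right-hand side is the
pull-back to `ℝⁿ × ℝ` of the Dirac section at the class of the origin. -/
structure IsPeriodizedFundamentalSolution (ε : ℝ) : Prop where
  /-- Normal convergence on compact sets that avoid the lattice points at time `0`. -/
  normal_convergence : ∀ K : Set (SpaceTime (N + 1)), IsCompact K →
    (∀ m, ((lat m, 0) : SpaceTime (N + 1)) ∉ K) →
    ∃ u : (Fin d → ℤ) → ℝ, Summable u ∧ ∀ m, ∀ p ∈ K, ‖seriesTerm lat s χ ε m p‖ ≤ u m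
  /-- Each term lies in the kernel of the operator. -/
  term_kernel : ∀ m, ContDiffOn ℝ ∞ (seriesTerm lat s χ ε m) {p | 0 < p.2} ∧
    ∀ p : SpaceTime (N + 1), 0 < p.2 → schrodingerOp ε (seriesTerm lat s χ ε m) p = 0
  /-- So does the sum. -/
  kernel : ContDiffOn ℝ ∞ (twistedSeries lat s χ ε) {p | 0 < p.2} ∧
    ∀ p : SpaceTime (N + 1), 0 < p.2 → schrodingerOp ε (twistedSeries lat s χ ε) p = 0
  /-- The sum is compatible with the identification of the bundle. -/
  equivariant : ∀ (m : Fin d → ℤ) (z : E (N + 1)) (t : ℝ),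
    twistedSeries lat s χ ε (reflLast (s m) z, t) =
      (((χ m : ℤˣ) : ℤ) : ℂ) * twistedSeries lat s χ ε (z + lat m, t)
  /-- The sum descends to a well-defined section of the bundle. -/
  descends : ∃! σ : Base lat s × Set.Ioi (0 : ℝ) → Bundle lat s χ,
    (∀ q, bundleProj lat s χ (σ q) = q.1) ∧
    ∀ (x : E (N + 1)) (t : Set.Ioi (0 : ℝ)),
      σ (Quot.mk _ x, t) = Quot.mk _ (x, twistedSeries lat s χ ε (x, t) • (1 : CliffordC (N + 1)))
  locallyIntegrable : LocallyIntegrable (twistedSeries lat s χ ε) volume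
  /-- The distributional equation on the covering space. -/
  lifted_equation : ∀ φ : SpaceTime (N + 1) → ℂ, ContDiff ℝ ∞ φ → HasCompactSupport φ →
    HasSum (fun m => (((χ m : ℤˣ) : ℤ) : ℂ) * φ (lat m, 0))
      (∫ p, twistedSeries lat s χ ε p * schrodingerOpTranspose ε φ p)

/-- `F` is a measurable set that represents almost every class of the quotient exactly once, so
that integration over the quotient is integration over `F`. -/
def IsFundDomain (F : Set (E (N + 1))) : Prop :=
  MeasurableSet F ∧
    ∀ᵐ x : E (N + 1), ∃! y, y ∈ F ∧ (Quot.mk _ y : Base lat s) = Quot.mk _ x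

/-- Smooth compactly supported sections of the bundle over (quotient) `× ℝ`, given by their
lifts to `ℝⁿ × ℝ`. A `ℂₙ`-valued function is smooth when its coordinates are, that is, when
its composition with each linear functional is. -/
structure IsTestSection (φ : SpaceTime (N + 1) → CliffordC (N + 1)) : Prop where
  smooth : ∀ ℓ : CliffordC (N + 1) →ₗ[ℂ] ℂ, ContDiff ℝ ∞ (fun p => ℓ (φ p))
  equivariant : ∀ (m : Fin d → ℤ) (z : E (N + 1)) (t : ℝ),
    φ (reflLast (s m) z, t) = (((χ m : ℤˣ) : ℤ) : ℂ) • φ (z + lat m, t)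
  compact_support : ∃ K : Set (SpaceTime (N + 1)), IsCompact K ∧
    ∀ (x : E (N + 1)) (t : ℝ), φ (x, t) ≠ 0 →
      ∃ y, (y, t) ∈ K ∧ (Quot.mk _ y : Base lat s) = Quot.mk _ x

/-- `(Δ - 𝐤 ∂ₜ) P = δ` on (quotient) `× ℝ` in the sense of distributions, with the Dirac
section `δ` at the class of the origin and time `0`: for every test section `φ`,
`∫ P (Δ + 𝐤 ∂ₜ) φ = φ(0, 0)` with the integral over (quotient) `× ℝ`. The `ℂₙ`-valued identity
is stated coordinatewise. -/
def IsFundamentalSolutionOnQuotient (ε : ℝ) : Prop :=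
  (∃ F, IsFundDomain lat s F) ∧
  ∀ F, IsFundDomain lat s F → ∀ φ, IsTestSection lat s χ φ →
    ∀ ℓ : CliffordC (N + 1) →ₗ[ℂ] ℂ,
      IntegrableOn (fun p => twistedSeries lat s χ ε p *
        schrodingerOpTranspose ε (fun p' => ℓ (φ p')) p) (F ×ˢ Set.univ) ∧
      ∫ p in F ×ˢ Set.univ, twistedSeries lat s χ ε p *
        schrodingerOpTranspose ε (fun p' => ℓ (φ p')) p = ℓ (φ (0, 0))

end Quotients

end PinQuotient

end

/-!
# Periodized fundamental solutions on Möbius strips and Klein bottles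

The kernel `e₋^ε` depends on the position only through its norm. The reflection of the last
coordinate is an isometry that permutes the lattice and preserves the parity factor `χ`, so the
reflections in the terms of the twisted series only permute the terms, and the series is the plain
periodization `∑ χ(m) e₋^ε(x - lat m, t)` (`IsTwistedLattice.twistedSeries_eq`). Everything is proved
for the lattices of `IsTwistedLattice`, which the Möbius strips and Klein bottles are instances of.

*The Euclidean identity.* For `f` bounded together with its derivatives of order at most two and
vanishing at late times, `∫ e₋^ε (Δ + 𝐤 ∂ₜ) f = f(0, 0)`
(`integral_eMinus_mul_schrodingerOpTranspose`). With `x = √t y` the pairing of the kernel at time `t`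
with `f` becomes a multiple of the Gaussian mean `G(t) = ∫ exp(-𝐤|y|²/4) f(√t y, t) dy`.
Differentiation in `t` produces a radial derivative of `f`, which an integration by parts against the
Gaussian turns into the Laplacian (`integral_gauss_mul_radial`). Hence the pairing with
`(Δ + 𝐤 ∂ₜ) f` is a multiple of `G'`, and the integral over time is evaluated by the fundamental
theorem of calculus; the prefactor of the kernel is exactly the normalization of the Gaussian
integral, since `𝐤 (ε - i) = 1`.

*Convergence.* As `Re 𝐤 > 0`, the kernel decays faster than every power of `|x|`, uniformly down to
`t = 0` (`exists_norm_eMinus_mul_pow_le`), and it is continuous away from the origin. As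
`∑ |lat m|^{-(n+2)}` converges over the nonzero lattice vectors, the series converges normally and is
locally integrable, and it may be integrated term by term against test functions. For `t > 0` write
`e₋^ε = exp(phase)`, where the phase of a translate is a quadratic polynomial in the translation
vector; the derivatives of the translates then have the same decay up to polynomial factors
(`exists_norm_iteratedFDeriv_eMinus_sub_le`), so the series is smooth and is differentiated term by
term.

*The quotient.* If the sign rule is multiplicative, the identifications are the orbits of a group of
isometries of `ℝⁿ` (`IsTwistedLattice.mk_eq_mk_iff`). Almost every point has pairwise different
distances to the lattice points, so the open Voronoi cell of the origin is a fundamental domain.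
Unfolding (`IsTwistedLattice.unfold`) turns the integral over any fundamental domain of the twisted
series against an equivariant function into the integral over `ℝⁿ × ℝ` of the kernel alone. A lifted
test section is bounded with all its derivatives, because its support is compact modulo isometries
that preserve the norms of its derivatives (`exists_hasBoundedJet`), and the Euclidean identity
applies to it directly.
-/

noncomputable section

namespace PinQuotient

/-! ### The kernel -/

section Kernel

variable {n : ℕ} {ε : ℝ}

/-- The parameter `𝐤` is the inverse of `ε - i`. -/
lemma kReg_mul (ε : ℝ) : kReg ε * ((ε : ℂ) - Complex.I) = 1 := by
  have h : ((ε : ℂ) ^ 2 + 1) ≠ 0 := by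
    norm_cast; positivity
  rw [kReg, div_mul_eq_mul_div, div_eq_one_iff_eq h]
  linear_combination -Complex.I_sq

lemma kReg_ne_zero (ε : ℝ) : kReg ε ≠ 0 := left_ne_zero_of_mul_eq_one (kReg_mul ε)

lemma sub_I_ne_zero (ε : ℝ) : (ε : ℂ) - Complex.I ≠ 0 := right_ne_zero_of_mul_eq_one (kReg_mul ε)

lemma kReg_re (ε : ℝ) : (kReg ε).re = ε / (ε ^ 2 + 1) := by
  have : kReg ε = (((ε / (ε ^ 2 + 1) : ℝ)) : ℂ) + (((1 / (ε ^ 2 + 1) : ℝ)) : ℂ) * Complex.I := by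
    rw [kReg]; push_cast; ring
  rw [this, Complex.add_re, Complex.re_ofReal_mul, Complex.ofReal_re, Complex.I_re, mul_zero, add_zero]

lemma kReg_re_pos (hε : 0 < ε) : 0 < (kReg ε).re := by
  rw [kReg_re]; positivity

/-- The constant `(i - ε) / (4π(ε - i))^{n/2}` in front of the kernel, with the real factor
`t^{-n/2}` split off. -/
def gaussConst (ε : ℝ) (n : ℕ) : ℂ :=
  (Complex.I - (ε : ℂ)) / (4 * (Real.pi : ℂ) * ((ε : ℂ) - Complex.I)) ^ ((n : ℂ) / 2)

lemma gaussConst_ne_zero (ε : ℝ) (n : ℕ) : gaussConst ε n ≠ 0 := by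
  have h := sub_I_ne_zero ε
  refine div_ne_zero (by rw [← neg_sub]; exact neg_ne_zero.2 h) ?_
  rw [Ne, Complex.cpow_eq_zero_iff]
  have hpi : (Real.pi : ℂ) ≠ 0 := by exact_mod_cast Real.pi_ne_zero
  simp [h]

lemma ofReal_cpow_half {t : ℝ} (ht : 0 < t) (n : ℕ) :
    (t : ℂ) ^ ((n : ℂ) / 2) = ((√t ^ n : ℝ) : ℂ) := by
  have : ((n : ℂ) / 2) = (((n : ℝ) / 2 : ℝ) : ℂ) := by push_cast; ring
  rw [this, ← Complex.ofReal_cpow ht.le, Real.sqrt_eq_rpow, ← Real.rpow_natCast, ← Real.rpow_mul ht.le]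
  congr 2; ring

lemma eMinus_of_nonpos {p : SpaceTime n} (hp : p.2 ≤ 0) : eMinus ε p = 0 := by
  rw [eMinus, if_neg (not_lt.2 hp)]

lemma eMinus_of_pos {p : SpaceTime n} (hp : 0 < p.2) :
    eMinus ε p = gaussConst ε n * (((√p.2 ^ n : ℝ) : ℂ))⁻¹ *
      Complex.exp (-(kReg ε / 4 * ((‖p.1‖ ^ 2 / p.2 : ℝ) : ℂ))) := by
  have h : ((ε : ℂ) ^ 2 + 1) ≠ 0 := by
    norm_cast; positivity
  have ht : (p.2 : ℂ) ≠ 0 := by exact_mod_cast hp.ne'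
  have hpow : (4 * (Real.pi : ℂ) * ((ε : ℂ) - Complex.I) * (p.2 : ℂ)) ^ ((n : ℂ) / 2) =
      (4 * (Real.pi : ℂ) * ((ε : ℂ) - Complex.I)) ^ ((n : ℂ) / 2) * ((√p.2 ^ n : ℝ) : ℂ) := by
    have hpi : (Real.pi : ℂ) ≠ 0 := by exact_mod_cast Real.pi_ne_zero
    have ha : 4 * (Real.pi : ℂ) * ((ε : ℂ) - Complex.I) ≠ 0 :=
      mul_ne_zero (mul_ne_zero (by norm_num) hpi) (sub_I_ne_zero ε)
    rw [← ofReal_cpow_half hp, Complex.cpow_def_of_ne_zero (mul_ne_zero ha ht),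
      Complex.cpow_def_of_ne_zero ha, Complex.cpow_def_of_ne_zero ht, ← Complex.exp_add,
      Complex.log_mul_ofReal _ hp _ ha, Complex.ofReal_log hp.le]
    ring_nf
  rw [eMinus, if_pos hp, hpow, gaussConst]
  congr 1
  · rw [div_mul_eq_div_div, div_eq_mul_inv]
  · congr 1
    rw [kReg]; push_cast; field_simp

/-- The kernel depends on the position only through its norm. -/
lemma eMinus_congr_norm {x y : E n} (h : ‖x‖ = ‖y‖) (t : ℝ) : eMinus ε (x, t) = eMinus ε (y, t) := by
  simp only [eMinus, h]

lemma norm_eMinus {p : SpaceTime n} (hp : 0 < p.2) :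
    ‖eMinus ε p‖ = ‖gaussConst ε n‖ * (√p.2 ^ n)⁻¹ *
      Real.exp (-((kReg ε).re / 4 * (‖p.1‖ ^ 2 / p.2))) := by
  rw [eMinus_of_pos hp, norm_mul, norm_mul, Complex.norm_exp, norm_inv, Complex.norm_real,
    Real.norm_of_nonneg (by positivity)]
  congr 2
  rw [Complex.neg_re, Complex.re_mul_ofReal]
  simp

/-- The exponent of the kernel, `log A - (n/2) log t - 𝐤|x|²/(4t)`, where `A` is the constant in
front of it. -/
def phase (ε : ℝ) {n : ℕ} (p : SpaceTime n) : ℂ :=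
  Complex.log (gaussConst ε n) - ((n : ℂ) / 2) * ((Real.log p.2 : ℝ) : ℂ)
    - kReg ε / 4 * ((‖p.1‖ ^ 2 / p.2 : ℝ) : ℂ)

lemma eMinus_eq_exp {p : SpaceTime n} (hp : 0 < p.2) : eMinus ε p = Complex.exp (phase ε p) := by
  have hs : Complex.exp (-((n : ℂ) / 2 * ((Real.log p.2 : ℝ) : ℂ))) =
      (((√p.2 ^ n : ℝ) : ℂ))⁻¹ := by
    rw [Complex.exp_neg, ← ofReal_cpow_half hp, Complex.cpow_def_of_ne_zero (by exact_mod_cast hp.ne'),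
      Complex.ofReal_log hp.le, mul_comm]
  rw [eMinus_of_pos hp, phase, sub_sub, sub_eq_add_neg, neg_add, Complex.exp_add, Complex.exp_add,
    Complex.exp_log (gaussConst_ne_zero ε n), hs]
  ring

/-- Decay of every polynomial order, with constants uniform down to `t = 0`. -/
lemma exists_norm_eMinus_mul_pow_le (hε : 0 < ε) (n j : ℕ) :
    ∃ C : ℝ, 0 ≤ C ∧ ∀ (x : E n) (t : ℝ), 0 ≤ t →
      ‖eMinus ε (x, t)‖ * ‖x‖ ^ (n + 2 * j) ≤ C * t ^ j := by
  set a := (kReg ε).re / 4 with ha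
  have hapos : 0 < a := by have := kReg_re_pos hε; positivity
  set q := n + 2 * j
  refine ⟨‖gaussConst ε n‖ * (q.factorial * Real.exp (1 / (4 * a))), by positivity, fun x t ht => ?_⟩
  rcases ht.eq_or_lt with rfl | ht
  · rw [eMinus_of_nonpos le_rfl]; simp; positivity
  -- with `y = ‖x‖ / √t`, the claim is that `y ^ q * exp (-a y²)` is bounded
  set y := ‖x‖ / √t with hy
  have hst : 0 < √t := Real.sqrt_pos.2 ht
  have hy0 : 0 ≤ y := by positivity
  have h1 : y ^ q * Real.exp (-(a * y ^ 2)) ≤ q.factorial * Real.exp (1 / (4 * a)) := by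
    have h2 := Real.pow_div_factorial_le_exp y hy0 q
    rw [div_le_iff₀ (by positivity)] at h2
    have h3 : y - a * y ^ 2 ≤ 1 / (4 * a) := by
      rw [le_div_iff₀ (by positivity)]
      nlinarith [sq_nonneg (2 * a * y - 1)]
    calc y ^ q * Real.exp (-(a * y ^ 2)) ≤ (Real.exp y * q.factorial) * Real.exp (-(a * y ^ 2)) := by
          gcongr
      _ = q.factorial * Real.exp (y - a * y ^ 2) := by rw [sub_eq_add_neg, Real.exp_add]; ring
      _ ≤ _ := by gcongr
  have hx : ‖x‖ = y * √t := by rw [hy]; field_simp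
  have hx2 : ‖x‖ ^ 2 / t = y ^ 2 := by
    rw [hx, mul_pow, Real.sq_sqrt ht.le]; field_simp
  rw [norm_eMinus (p := (x, t)) ht]
  simp only
  rw [hx2, ← ha, hx, mul_pow, show √t ^ q = √t ^ n * t ^ j by
    rw [pow_add, pow_mul, Real.sq_sqrt ht.le]]
  calc _ = ‖gaussConst ε n‖ * (y ^ q * Real.exp (-(a * y ^ 2))) * t ^ j := by field_simp
    _ ≤ ‖gaussConst ε n‖ * (q.factorial * Real.exp (1 / (4 * a))) * t ^ j := by gcongr

lemma norm_eMinus_le (hε : 0 < ε) {p : SpaceTime n} (hp : 0 < p.2) :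
    ‖eMinus ε p‖ ≤ ‖gaussConst ε n‖ * (√p.2 ^ n)⁻¹ := by
  rw [norm_eMinus hp]
  refine mul_le_of_le_one_right (by positivity) (Real.exp_le_one_iff.2 ?_)
  have := kReg_re_pos hε
  rw [neg_nonpos]; positivity

lemma measurable_eMinus (ε : ℝ) (n : ℕ) : Measurable (eMinus ε : SpaceTime n → ℂ) := by
  have : (eMinus ε : SpaceTime n → ℂ) = fun p => if 0 < p.2 then
      gaussConst ε n * (((√p.2 ^ n : ℝ) : ℂ))⁻¹ *
      Complex.exp (-(kReg ε / 4 * ((‖p.1‖ ^ 2 / p.2 : ℝ) : ℂ))) else 0 := by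
    funext p
    split_ifs with h
    · exact eMinus_of_pos h
    · exact eMinus_of_nonpos (not_lt.1 h)
  rw [this]
  refine Measurable.ite (measurableSet_lt measurable_const measurable_snd) ?_ measurable_const
  fun_prop

/-- The phase is smooth, unlike the complex power in the definition of the kernel, whose regularity
would need an argument about the branch cut. -/
lemma contDiffOn_phase (ε : ℝ) (n : ℕ) :
    ContDiffOn ℝ ∞ (phase ε : SpaceTime n → ℂ) {p | 0 < p.2} := by
  have hc : ContDiff ℝ ∞ ((↑) : ℝ → ℂ) := Complex.ofRealCLM.contDiff
  have h1 : ContDiffOn ℝ ∞ (fun p : SpaceTime n => Real.log p.2) {p | 0 < p.2} :=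
    contDiff_snd.contDiffOn.log fun p hp => (ne_of_gt hp)
  have h2 : ContDiffOn ℝ ∞ (fun p : SpaceTime n => ‖p.1‖ ^ 2 / p.2) {p | 0 < p.2} :=
    (contDiff_fst.norm_sq ℝ).contDiffOn.div contDiff_snd.contDiffOn fun p hp => (ne_of_gt hp)
  exact (contDiffOn_const.sub (contDiffOn_const.mul (hc.comp_contDiffOn h1))).sub
    (contDiffOn_const.mul (hc.comp_contDiffOn h2))

lemma isOpen_pos_time : IsOpen {p : SpaceTime n | 0 < p.2} :=
  isOpen_lt continuous_const continuous_snd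

lemma contDiffOn_eMinus (ε : ℝ) (n : ℕ) :
    ContDiffOn ℝ ∞ (eMinus ε : SpaceTime n → ℂ) {p | 0 < p.2} :=
  ((contDiffOn_phase ε n).cexp).congr fun _ hp => eMinus_eq_exp hp

/-- The kernel is continuous away from its pole: off the origin it is flat as `t → 0`. -/
lemma continuousAt_eMinus (hε : 0 < ε) {p : SpaceTime n} (hp : p ≠ 0) :
    ContinuousAt (eMinus ε : SpaceTime n → ℂ) p := by
  rcases lt_trichotomy p.2 0 with h | h | h
  · refine (continuousAt_const (y := (0 : ℂ))).congr ?_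
    filter_upwards [(isOpen_lt continuous_snd continuous_const).mem_nhds h] with q hq
    exact (eMinus_of_nonpos (le_of_lt hq)).symm
  · have hx : p.1 ≠ 0 := fun h1 => hp (Prod.ext h1 h)
    obtain ⟨C, hC, hb⟩ := exists_norm_eMinus_mul_pow_le hε n 1
    rw [ContinuousAt, eMinus_of_nonpos h.le]
    have hlim : Filter.Tendsto (fun q : SpaceTime n => C * |q.2| ^ 1 / ‖q.1‖ ^ (n + 2 * 1))
        (nhds p) (nhds 0) := by
      have : ContinuousAt (fun q : SpaceTime n => C * |q.2| ^ 1 / ‖q.1‖ ^ (n + 2 * 1)) p := by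
        refine ContinuousAt.div (by fun_prop) (by fun_prop) ?_
        exact pow_ne_zero _ (norm_ne_zero_iff.2 hx)
      have h0 := this.tendsto
      simpa [h] using h0
    refine squeeze_zero_norm' ?_ hlim
    filter_upwards [(isOpen_ne_fun continuous_fst continuous_const).mem_nhds hx] with q hq
    have hq' : 0 < ‖q.1‖ := norm_pos_iff.2 hq
    rcases le_or_gt q.2 0 with h2 | h2
    · rw [eMinus_of_nonpos h2, norm_zero]; positivity
    · rw [le_div_iff₀ (by positivity), abs_of_pos h2]
      exact hb q.1 q.2 h2.le
  · exact ((contDiffOn_eMinus ε n).continuousOn).continuousAt (isOpen_pos_time.mem_nhds h)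

lemma integrable_exp_neg_mul_norm_sq {a : ℝ} (ha : 0 < a) :
    Integrable (fun y : E n => Real.exp (-(a * ‖y‖ ^ 2))) := by
  have h := (GaussianFourier.integrable_cexp_neg_mul_sq_norm_add (V := E n) (b := (a : ℂ))
    (by simpa using ha) 0 0).norm
  refine h.congr (Filter.Eventually.of_forall fun y => ?_)
  simp only [zero_mul, add_zero, Complex.norm_exp]
  congr 1
  have : -(a : ℂ) * (‖y‖ : ℂ) ^ 2 = ((-(a * ‖y‖ ^ 2) : ℝ) : ℂ) := by push_cast; ring
  rw [this, Complex.ofReal_re]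

/-- The mass of the absolute value of the kernel does not depend on time. -/
lemma integrable_eMinus_slice (hε : 0 < ε) {t : ℝ} (ht : 0 < t) :
    Integrable (fun x : E n => eMinus ε (x, t)) ∧
      ∫ x : E n, ‖eMinus ε (x, t)‖ =
        ∫ y : E n, ‖gaussConst ε n‖ * Real.exp (-((kReg ε).re / 4 * ‖y‖ ^ 2)) := by
  have hk := kReg_re_pos hε
  have hst : 0 < √t := Real.sqrt_pos.2 ht
  have hform : ∀ x : E n, ‖eMinus ε (x, t)‖ = (√t ^ n)⁻¹ *
      (‖gaussConst ε n‖ * Real.exp (-((kReg ε).re / 4 * ‖(√t)⁻¹ • x‖ ^ 2))) := by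
    intro x
    rw [norm_eMinus (p := (x, t)) ht, norm_smul, norm_inv, Real.norm_of_nonneg hst.le, mul_pow,
      inv_pow, Real.sq_sqrt ht.le, div_eq_inv_mul]
    ring_nf
  constructor
  · rw [← integrable_norm_iff]
    · simp_rw [hform]
      refine Integrable.const_mul ?_ _
      exact ((integrable_exp_neg_mul_norm_sq (n := n) (a := (kReg ε).re / 4)
        (by positivity)).const_mul _).comp_smul (inv_ne_zero hst.ne')
    · exact ((measurable_eMinus ε n).comp measurable_prodMk_right).aestronglyMeasurable
  · simp_rw [hform]
    rw [integral_const_mul, Measure.integral_comp_smul volume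
      (fun y : E n => ‖gaussConst ε n‖ * Real.exp (-((kReg ε).re / 4 * ‖y‖ ^ 2)))]
    rw [finrank_euclideanSpace_fin, inv_pow, inv_inv, abs_of_pos (by positivity), smul_eq_mul,
      ← mul_assoc, inv_mul_cancel₀ (by positivity), one_mul]

/-- The kernel is integrable on every strip of finite height. -/
lemma integrableOn_eMinus (hε : 0 < ε) (n : ℕ) (T : ℝ) :
    IntegrableOn (eMinus ε : SpaceTime n → ℂ) (Set.univ ×ˢ Set.Iic T) := by
  have h0 : IntegrableOn (eMinus ε : SpaceTime n → ℂ) (Set.univ ×ˢ Set.Ioc 0 T) := by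
    rw [IntegrableOn, Measure.volume_eq_prod, ← Measure.prod_restrict, Measure.restrict_univ,
      integrable_prod_iff' (measurable_eMinus ε n).aestronglyMeasurable]
    have hae : ∀ᵐ t ∂(volume.restrict (Set.Ioc (0 : ℝ) T)), t ∈ Set.Ioc 0 T :=
      ae_restrict_mem measurableSet_Ioc
    refine ⟨hae.mono fun t ht => (integrable_eMinus_slice hε ht.1).1, ?_⟩
    refine (integrable_const (∫ y : E n, ‖gaussConst ε n‖ *
      Real.exp (-((kReg ε).re / 4 * ‖y‖ ^ 2)))).congr ?_
    exact hae.mono fun t ht => (integrable_eMinus_slice hε ht.1).2.symm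
  refine IntegrableOn.of_forall_sdiff_eq_zero h0 (MeasurableSet.univ.prod measurableSet_Iic) ?_
  rintro ⟨x, t⟩ ⟨⟨_, h1⟩, h2⟩
  refine eMinus_of_nonpos (not_lt.1 fun h3 => h2 ⟨trivial, h3, h1⟩)

end Kernel

/-! ### Second-order jets -/

section Jets

variable {n : ℕ} {ε : ℝ}

/-- The Laplacian in the position variable, as a sum of entries of the space-time Hessian. -/
def spaceLap {n : ℕ} (D : SpaceTime n →L[ℝ] SpaceTime n →L[ℝ] ℂ) : ℂ :=
  ∑ i, D (EuclideanSpace.basisFun (Fin n) ℝ i, 0) (EuclideanSpace.basisFun (Fin n) ℝ i, 0)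

lemma fderiv_slice {f : SpaceTime n → ℂ} {y : E n} {t : ℝ} (hf : DifferentiableAt ℝ f (y, t)) :
    fderiv ℝ (fun y : E n => f (y, t)) y =
      (fderiv ℝ f (y, t)).comp (ContinuousLinearMap.inl ℝ (E n) ℝ) :=
  (hf.hasFDerivAt.comp y (hasFDerivAt_prodMk_left y t)).fderiv

lemma fderiv_fderiv_slice {f : SpaceTime n → ℂ} {y : E n} {t : ℝ} (hf : ContDiffAt ℝ 2 f (y, t))
    (v w : E n) :
    fderiv ℝ (fderiv ℝ (fun y : E n => f (y, t))) y v w =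
      fderiv ℝ (fderiv ℝ f) (y, t) (v, 0) (w, 0) := by
  have hev : fderiv ℝ (fun y : E n => f (y, t)) =ᶠ[nhds y] fun z =>
      (fderiv ℝ f (z, t)).comp (ContinuousLinearMap.inl ℝ (E n) ℝ) := by
    have h1 : ∀ᶠ q in nhds (y, t), ContDiffAt ℝ 2 f q := hf.eventually (by simp)
    have h2 : Filter.Tendsto (fun z : E n => (z, t)) (nhds y) (nhds (y, t)) :=
      (Continuous.prodMk_left t).continuousAt
    filter_upwards [h2.eventually h1] with z hz
    exact fderiv_slice (hz.differentiableAt (by norm_num))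
  have h3 : DifferentiableAt ℝ (fderiv ℝ f) (y, t) :=
    (hf.fderiv_right (m := 1) (by norm_num)).differentiableAt (by norm_num)
  set L := (ContinuousLinearMap.compL ℝ (E n) (SpaceTime n) ℂ).flip
    (ContinuousLinearMap.inl ℝ (E n) ℝ)
  have h4 : HasFDerivAt (fun z : E n =>
      (fderiv ℝ f (z, t)).comp (ContinuousLinearMap.inl ℝ (E n) ℝ))
      (L.comp ((fderiv ℝ (fderiv ℝ f) (y, t)).comp (ContinuousLinearMap.inl ℝ (E n) ℝ))) y :=
    L.hasFDerivAt.comp y (h3.hasFDerivAt.comp y (hasFDerivAt_prodMk_left y t))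
  rw [hev.fderiv_eq, h4.fderiv]
  simp [L]

lemma laplacian_slice {f : SpaceTime n → ℂ} {p : SpaceTime n} (hf : ContDiffAt ℝ 2 f p) :
    Laplacian.laplacian (fun y : E n => f (y, p.2)) p.1 = spaceLap (fderiv ℝ (fderiv ℝ f) p) := by
  rw [InnerProductSpace.laplacian_eq_iteratedFDeriv_orthonormalBasis _
    (EuclideanSpace.basisFun (Fin n) ℝ)]
  refine Finset.sum_congr rfl fun i _ => ?_
  rw [iteratedFDeriv_two_apply]
  exact fderiv_fderiv_slice hf _ _

lemma deriv_slice {f : SpaceTime n → ℂ} {p : SpaceTime n} (hf : DifferentiableAt ℝ f p) :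
    deriv (fun τ : ℝ => f (p.1, τ)) p.2 = fderiv ℝ f p (0, 1) := by
  have h := (hf.hasFDerivAt.comp p.2 (hasFDerivAt_prodMk_right p.1 p.2)).hasDerivAt.deriv
  simpa [Function.comp_def] using h

lemma schrodingerOp_eq {f : SpaceTime n → ℂ} {p : SpaceTime n} (hf : ContDiffAt ℝ 2 f p) :
    schrodingerOp ε f p = spaceLap (fderiv ℝ (fderiv ℝ f) p) - kReg ε * fderiv ℝ f p (0, 1) := by
  rw [schrodingerOp, laplacian_slice hf, deriv_slice (hf.differentiableAt (by norm_num))]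

lemma schrodingerOpTranspose_eq {f : SpaceTime n → ℂ} {p : SpaceTime n}
    (hf : ContDiffAt ℝ 2 f p) :
    schrodingerOpTranspose ε f p =
      spaceLap (fderiv ℝ (fderiv ℝ f) p) + kReg ε * fderiv ℝ f p (0, 1) := by
  rw [schrodingerOpTranspose, laplacian_slice hf, deriv_slice (hf.differentiableAt (by norm_num))]

lemma norm_spaceLap_le (D : SpaceTime n →L[ℝ] SpaceTime n →L[ℝ] ℂ) : ‖spaceLap D‖ ≤ n * ‖D‖ := by
  refine (norm_sum_le _ _).trans ?_
  have : ∀ i ∈ (Finset.univ : Finset (Fin n)), ‖D (EuclideanSpace.basisFun (Fin n) ℝ i, 0)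
      (EuclideanSpace.basisFun (Fin n) ℝ i, 0)‖ ≤ ‖D‖ := by
    intro i _
    refine (D.le_opNorm₂ _ _).trans ?_
    simp [Prod.norm_def]
  simpa using Finset.sum_le_sum this

lemma continuous_spaceLap : Continuous (spaceLap (n := n)) := by
  unfold spaceLap; fun_prop

lemma continuous_schrodingerOpTranspose (ε : ℝ) {f : SpaceTime n → ℂ} (hf : ContDiff ℝ 2 f) :
    Continuous (schrodingerOpTranspose ε f) := by
  have h : schrodingerOpTranspose ε f = fun p =>
      spaceLap (fderiv ℝ (fderiv ℝ f) p) + kReg ε * fderiv ℝ f p (0, 1) :=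
    funext fun p => schrodingerOpTranspose_eq hf.contDiffAt
  have h1 : ContDiff ℝ 1 (fderiv ℝ f) := hf.fderiv_right (by norm_num)
  have h2 : Continuous (fderiv ℝ (fderiv ℝ f)) := h1.continuous_fderiv (by norm_num)
  have h3 := h1.continuous
  rw [h]
  exact (continuous_spaceLap.comp h2).add (continuous_const.mul (h3.clm_apply continuous_const))

/-- A twice continuously differentiable function, bounded together with its derivatives of order
at most two. -/
structure HasBoundedJet (f : SpaceTime n → ℂ) (C : ℝ) : Prop where
  contDiff : ContDiff ℝ 2 f
  norm_le : ∀ p, ‖f p‖ ≤ C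
  norm_fderiv_le : ∀ p, ‖fderiv ℝ f p‖ ≤ C
  norm_fderiv_fderiv_le : ∀ p, ‖fderiv ℝ (fderiv ℝ f) p‖ ≤ C

lemma HasBoundedJet.nonneg {f : SpaceTime n → ℂ} {C : ℝ} (hf : HasBoundedJet f C) : 0 ≤ C :=
  (norm_nonneg _).trans (hf.norm_le 0)

lemma HasBoundedJet.norm_schrodingerOpTranspose_le {f : SpaceTime n → ℂ} {C : ℝ}
    (hf : HasBoundedJet f C) (ε : ℝ) (p : SpaceTime n) :
    ‖schrodingerOpTranspose ε f p‖ ≤ (n + ‖kReg ε‖) * C := by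
  rw [schrodingerOpTranspose_eq hf.contDiff.contDiffAt, add_mul]
  refine (norm_add_le _ _).trans (add_le_add ?_ ?_)
  · exact (norm_spaceLap_le _).trans (by gcongr; exact hf.norm_fderiv_fderiv_le p)
  · rw [norm_mul]
    gcongr
    refine ((fderiv ℝ f p).le_opNorm _).trans ?_
    simpa [Prod.norm_def] using hf.norm_fderiv_le p

end Jets

/-! ### Gaussian integrals -/

section Gaussian

variable {n : ℕ} {ε : ℝ}

/-- The complex Gaussian `exp (-b|y|²)`. -/
def gauss (b : ℂ) (y : E n) : ℂ := Complex.exp (-(b * ((‖y‖ ^ 2 : ℝ) : ℂ)))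

lemma norm_gauss (b : ℂ) (y : E n) : ‖gauss b y‖ = Real.exp (-(b.re * ‖y‖ ^ 2)) := by
  rw [gauss, Complex.norm_exp, Complex.neg_re, Complex.re_mul_ofReal]

lemma continuous_gauss (b : ℂ) : Continuous (gauss b : E n → ℂ) := by
  unfold gauss; fun_prop

lemma integrable_one_add_norm_mul_gauss {b : ℂ} (hb : 0 < b.re) :
    Integrable (fun y : E n => (1 + ‖y‖) * ‖gauss b y‖) := by
  have ha : 0 < b.re / 2 := by positivity
  refine ((integrable_exp_neg_mul_norm_sq (n := n) ha).const_mul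
    (Real.exp (1 / (2 * b.re)))).mono' ?_ (Filter.Eventually.of_forall fun y => ?_)
  · exact ((continuous_const.add continuous_norm).mul
      (continuous_gauss b).norm).aestronglyMeasurable
  · rw [Real.norm_of_nonneg (by positivity), norm_gauss, ← Real.exp_add]
    have h1 : 1 + ‖y‖ ≤ Real.exp ‖y‖ := by rw [add_comm]; exact Real.add_one_le_exp _
    refine (mul_le_mul_of_nonneg_right h1 (Real.exp_pos _).le).trans ?_
    rw [← Real.exp_add, Real.exp_le_exp]
    have : ‖y‖ - b.re / 2 * ‖y‖ ^ 2 ≤ 1 / (2 * b.re) := by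
      rw [le_div_iff₀ (by positivity)]
      nlinarith [sq_nonneg (b.re * ‖y‖ - 1)]
    linarith

/-- A Gaussian times a continuous function of linear growth is integrable. -/
lemma integrable_gauss_mul {b : ℂ} (hb : 0 < b.re) {F : E n → ℂ} {C : ℝ} (hF : Continuous F)
    (hC : ∀ y, ‖F y‖ ≤ C * (1 + ‖y‖)) : Integrable (fun y => gauss b y * F y) := by
  refine ((integrable_one_add_norm_mul_gauss (n := n) hb).const_mul C).mono'
    ((continuous_gauss b).mul hF).aestronglyMeasurable (Filter.Eventually.of_forall fun y => ?_)
  rw [norm_mul]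
  calc _ ≤ ‖gauss b y‖ * (C * (1 + ‖y‖)) := by gcongr; exact hC y
    _ = _ := by ring

lemma hasFDerivAt_gauss (b : ℂ) (y : E n) :
    HasFDerivAt (gauss b : E n → ℂ)
      (gauss b y • (-(b • (Complex.ofRealCLM.comp (2 • innerSL ℝ y))))) y := by
  have h1 : HasFDerivAt (fun y : E n => ((‖y‖ ^ 2 : ℝ) : ℂ))
      (Complex.ofRealCLM.comp (2 • innerSL ℝ y)) y :=
    Complex.ofRealCLM.hasFDerivAt.comp y (hasStrictFDerivAt_norm_sq y).hasFDerivAt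
  exact (h1.const_mul b).neg.cexp

lemma fderiv_gauss_apply (b : ℂ) (y v : E n) :
    fderiv ℝ (gauss b : E n → ℂ) y v = -(2 * b) * (((inner ℝ y v : ℝ) : ℂ) * gauss b y) := by
  rw [(hasFDerivAt_gauss b y).fderiv]
  simp
  ring

/-- The Gaussian mean of the radial derivative is a multiple of the mean of the Laplacian. -/
lemma integral_gauss_mul_radial {b : ℂ} (hb : 0 < b.re) {h : E n → ℂ} {C : ℝ}
    (hh : ContDiff ℝ 2 h) (h1 : ∀ y, ‖fderiv ℝ h y‖ ≤ C)
    (h2 : ∀ y, ‖fderiv ℝ (fderiv ℝ h) y‖ ≤ C) :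
    2 * b * ∫ y, gauss b y * fderiv ℝ h y y =
      ∫ y, gauss b y * ∑ i, fderiv ℝ (fderiv ℝ h) y (EuclideanSpace.basisFun (Fin n) ℝ i)
        (EuclideanSpace.basisFun (Fin n) ℝ i) := by
  set e := EuclideanSpace.basisFun (Fin n) ℝ with he
  have hC : 0 ≤ C := (norm_nonneg _).trans (h1 0)
  have hd1 : ContDiff ℝ 1 (fderiv ℝ h) := hh.fderiv_right (by norm_num)
  have hc1 := hd1.continuous
  have hc2 : Continuous (fderiv ℝ (fderiv ℝ h)) := hd1.continuous_fderiv (by norm_num)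
  have hn : ∀ i, ‖e i‖ = 1 := fun i => e.norm_eq_one i
  have hb1 : ∀ i y, ‖fderiv ℝ h y (e i)‖ ≤ C := fun i y =>
    ((fderiv ℝ h y).le_opNorm _).trans (by rw [hn, mul_one]; exact h1 y)
  have hb2 : ∀ i y, ‖fderiv ℝ (fderiv ℝ h) y (e i) (e i)‖ ≤ C := fun i y =>
    ((fderiv ℝ (fderiv ℝ h) y).le_opNorm₂ _ _).trans (by rw [hn, mul_one, mul_one]; exact h2 y)
  have hlin : ∀ y : E n, C ≤ C * (1 + ‖y‖) := fun y =>
    le_mul_of_one_le_right hC (by linarith [norm_nonneg y])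
  have hin : ∀ (y : E n) i, |inner ℝ y (e i)| ≤ ‖y‖ := fun y i =>
    (abs_real_inner_le_norm _ _).trans (by rw [hn, mul_one])
  have hI1 : ∀ i, Integrable (fun y => gauss b y * (((inner ℝ y (e i) : ℝ) : ℂ)
      * fderiv ℝ h y (e i))) := fun i => by
    refine integrable_gauss_mul hb (C := C) ?_ fun y => ?_
    · exact (Complex.continuous_ofReal.comp (continuous_id.inner continuous_const)).mul
        (hc1.clm_apply continuous_const)
    · rw [norm_mul, Complex.norm_real, Real.norm_eq_abs]
      calc _ ≤ ‖y‖ * C := by gcongr; exacts [hin y i, hb1 i y]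
        _ ≤ _ := by nlinarith
  have hI2 : ∀ i, Integrable (fun y => gauss b y * fderiv ℝ (fderiv ℝ h) y (e i) (e i)) :=
    fun i => integrable_gauss_mul hb (C := C)
      ((hc2.clm_apply continuous_const).clm_apply continuous_const)
      fun y => (hb2 i y).trans (hlin y)
  have hI3 : ∀ i, Integrable (fun y => gauss b y * fderiv ℝ h y (e i)) :=
    fun i => integrable_gauss_mul hb (C := C) (hc1.clm_apply continuous_const)
      fun y => (hb1 i y).trans (hlin y)
  have hdd : ∀ i y, fderiv ℝ (fun z => fderiv ℝ h z (e i)) y (e i) =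
      fderiv ℝ (fderiv ℝ h) y (e i) (e i) := fun i y => by
    have h3 := ((hd1.differentiable (by norm_num)) y).hasFDerivAt
    have h4 := h3.clm_apply (hasFDerivAt_const (e i) y)
    rw [h4.fderiv]; simp
  -- integration by parts in each coordinate direction
  have hibp : ∀ i, ∫ y, gauss b y * fderiv ℝ (fderiv ℝ h) y (e i) (e i) =
      2 * b * ∫ y, gauss b y * (((inner ℝ y (e i) : ℝ) : ℂ) * fderiv ℝ h y (e i)) := fun i => by
    have hpt : ∀ y, fderiv ℝ (gauss b : E n → ℂ) y (e i) * fderiv ℝ h y (e i) =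
        -(2 * b) * (gauss b y * (((inner ℝ y (e i) : ℝ) : ℂ) * fderiv ℝ h y (e i))) := fun y => by
      rw [fderiv_gauss_apply]; ring
    have h5 := integral_mul_fderiv_eq_neg_fderiv_mul_of_integrable (μ := (volume : Measure (E n)))
      (f := gauss b) (g := fun z => fderiv ℝ h z (e i)) (v := e i)
      (by simp_rw [hpt]; exact (hI1 i).const_mul _) (by simp_rw [hdd]; exact hI2 i) (hI3 i)
      (fun y _ => (hasFDerivAt_gauss b y).differentiableAt)
      (fun y _ => ((hd1.differentiable (by norm_num)) y).clm_apply (differentiableAt_const _))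
    simp_rw [hdd, hpt] at h5
    rw [h5, integral_const_mul]; ring
  have hrad : ∀ y, gauss b y * fderiv ℝ h y y =
      ∑ i, gauss b y * (((inner ℝ y (e i) : ℝ) : ℂ) * fderiv ℝ h y (e i)) := fun y => by
    rw [← Finset.mul_sum]
    congr 1
    conv_lhs => rw [← e.sum_repr' y, map_sum]
    refine Finset.sum_congr rfl fun i _ => ?_
    rw [map_smul, e.sum_repr' y, real_inner_comm]
    simp
  simp_rw [hrad, Finset.mul_sum]
  rw [integral_finsetSum _ fun i _ => hI1 i, integral_finsetSum _ fun i _ => hI2 i, Finset.mul_sum]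
  exact Finset.sum_congr rfl fun i _ => (hibp i).symm

end Gaussian

/-! ### The fundamental solution property on Euclidean space -/

section Core

variable {n : ℕ} {ε : ℝ}

lemma eMinus_eq_gauss {t : ℝ} (ht : 0 < t) (x : E n) :
    eMinus ε (x, t) = gaussConst ε n * (((√t ^ n : ℝ) : ℂ))⁻¹ *
      gauss (kReg ε / 4) ((√t)⁻¹ • x) := by
  have hst : 0 < √t := Real.sqrt_pos.2 ht
  have h : ‖(√t)⁻¹ • x‖ ^ 2 = ‖x‖ ^ 2 / t := by
    rw [norm_smul, norm_inv, Real.norm_of_nonneg hst.le, mul_pow, inv_pow, Real.sq_sqrt ht.le,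
      div_eq_inv_mul]
  rw [eMinus_of_pos (p := (x, t)) ht, gauss, h]

/-- Parabolic rescaling of an integral against the kernel. -/
lemma integral_eMinus_mul {t : ℝ} (ht : 0 < t) (F : E n → ℂ) :
    ∫ x, eMinus ε (x, t) * F x =
      gaussConst ε n * ∫ y, gauss (kReg ε / 4) y * F (√t • y) := by
  have hst : 0 < √t := Real.sqrt_pos.2 ht
  have h1 : ∀ x : E n, eMinus ε (x, t) * F x = gaussConst ε n * ((((√t ^ n : ℝ) : ℂ))⁻¹ *
      (gauss (kReg ε / 4) ((√t)⁻¹ • x) * F x)) := fun x => by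
    rw [eMinus_eq_gauss ht]; ring
  have h2 := Measure.integral_comp_smul (volume : Measure (E n))
    (fun x => gauss (kReg ε / 4) ((√t)⁻¹ • x) * F x) (√t)
  simp_rw [h1]
  rw [integral_const_mul, integral_const_mul]
  simp_rw [inv_smul_smul₀ hst.ne'] at h2
  rw [h2, finrank_euclideanSpace_fin, abs_of_pos (by positivity), Complex.real_smul,
    Complex.ofReal_inv]

/-- The constant in front of the kernel normalizes its total mass to `-1/𝐤`. -/
lemma integral_gauss_kReg (hε : 0 < ε) :
    -(gaussConst ε n * kReg ε * ∫ y : E n, gauss (kReg ε / 4) y) = 1 := by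
  have hre : 0 < (kReg ε / 4).re := by
    have h := kReg_re_pos hε
    have h4 : (kReg ε / 4).re = (kReg ε).re / 4 := by simp
    rw [h4]; positivity
  have h1 : ∫ y : E n, gauss (kReg ε / 4) y =
      (4 * (Real.pi : ℂ) * ((ε : ℂ) - Complex.I)) ^ ((n : ℂ) / 2) := by
    have h2 := GaussianFourier.integral_cexp_neg_mul_sq_norm (V := E n) hre
    rw [finrank_euclideanSpace_fin] at h2
    have h3 : (Real.pi : ℂ) / (kReg ε / 4) = 4 * (Real.pi : ℂ) * ((ε : ℂ) - Complex.I) := by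
      rw [div_eq_iff (div_ne_zero (kReg_ne_zero ε) (by norm_num))]
      linear_combination (-(Real.pi : ℂ)) * kReg_mul ε
    rw [← h3, ← h2]
    refine integral_congr_ae (Filter.Eventually.of_forall fun y => ?_)
    simp [gauss]
  have hA : (4 * (Real.pi : ℂ) * ((ε : ℂ) - Complex.I)) ^ ((n : ℂ) / 2) ≠ 0 := by
    have hne := gaussConst_ne_zero ε n
    rw [gaussConst] at hne
    exact fun h0 => hne (by rw [h0, div_zero])
  rw [h1, gaussConst]
  field_simp
  linear_combination kReg_mul ε

/-- The Gaussian mean `t ↦ ∫ exp (-𝐤|y|²/4) f (√t y, t) dy`, a multiple of the pairing of the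
kernel at time `t` with `f`. -/
def gaussMean (ε : ℝ) (f : SpaceTime n → ℂ) (t : ℝ) : ℂ :=
  ∫ y : E n, gauss (kReg ε / 4) y * f (√t • y, t)

lemma kReg_div_four_re_pos (hε : 0 < ε) : 0 < (kReg ε / 4).re := by
  have h := kReg_re_pos hε
  have h4 : (kReg ε / 4).re = (kReg ε).re / 4 := by simp
  rw [h4]; positivity

lemma continuous_gaussMean (hε : 0 < ε) {f : SpaceTime n → ℂ} {C : ℝ} (hf : HasBoundedJet f C) :
    Continuous (gaussMean ε f) := by
  have hfc := hf.contDiff.continuous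
  have hG := continuous_gauss (n := n) (kReg ε / 4)
  refine continuous_of_dominated (bound := fun y => C * ((1 + ‖y‖) * ‖gauss (kReg ε / 4) y‖))
    (fun t => ?_) (fun t => Filter.Eventually.of_forall fun y => ?_) ?_
    (Filter.Eventually.of_forall fun y => ?_)
  · exact (hG.mul (hfc.comp (by fun_prop))).aestronglyMeasurable
  · rw [norm_mul, mul_comm]
    have h1 := hf.norm_le (√t • y, t)
    calc _ ≤ C * ‖gauss (kReg ε / 4) y‖ := by gcongr
      _ ≤ C * ((1 + ‖y‖) * ‖gauss (kReg ε / 4) y‖) := by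
        refine mul_le_mul_of_nonneg_left ?_ hf.nonneg
        exact le_mul_of_one_le_left (norm_nonneg _) (by linarith [norm_nonneg y])
  · exact (integrable_one_add_norm_mul_gauss (kReg_div_four_re_pos hε)).const_mul C
  · exact continuous_const.mul (hfc.comp (by fun_prop))

lemma fderiv_spaceTime_apply (D : SpaceTime n →L[ℝ] ℂ) (c : ℝ) (y : E n) :
    D (c • y, 1) = c * D (y, 0) + D (0, 1) := by
  have : ((c • y, 1) : SpaceTime n) = c • (y, 0) + (0, 1) := by simp
  rw [this, map_add, map_smul, Complex.real_smul]

/-- Time differentiation of the Gaussian mean, before the integration by parts. -/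
lemma hasDerivAt_gaussMean_aux (hε : 0 < ε) {f : SpaceTime n → ℂ} {C : ℝ} (hf : HasBoundedJet f C)
    {t : ℝ} (ht : 0 < t) :
    HasDerivAt (gaussMean ε f) (∫ y : E n, gauss (kReg ε / 4) y *
      fderiv ℝ f (√t • y, t) ((1 / (2 * √t)) • y, 1)) t := by
  have hfc := hf.contDiff.continuous
  have hd : Differentiable ℝ f := hf.contDiff.differentiable (by norm_num)
  have hfd : Continuous (fderiv ℝ f) := hf.contDiff.continuous_fderiv (by norm_num)
  have hG := continuous_gauss (n := n) (kReg ε / 4)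
  have hb := kReg_div_four_re_pos hε
  have hC := hf.nonneg
  set c := 1 / (2 * √(t / 2)) with hc
  have hsq : 0 < √(t / 2) := Real.sqrt_pos.2 (by positivity)
  refine (hasDerivAt_integral_of_dominated_loc_of_deriv_le (s := Set.Ioi (t / 2))
    (bound := fun y => C * (c + 1) * ((1 + ‖y‖) * ‖gauss (kReg ε / 4) y‖))
    (F := fun τ (y : E n) => gauss (kReg ε / 4) y * f (√τ • y, τ))
    (F' := fun τ (y : E n) => gauss (kReg ε / 4) y *
      fderiv ℝ f (√τ • y, τ) ((1 / (2 * √τ)) • y, 1))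
    (Ioi_mem_nhds (by linarith)) (Filter.Eventually.of_forall fun τ => ?_) ?_ ?_
    (Filter.Eventually.of_forall fun y τ hτ => ?_) ?_
    (Filter.Eventually.of_forall fun y τ hτ => ?_)).2
  · exact (hG.mul (hfc.comp (by fun_prop))).aestronglyMeasurable
  · refine integrable_gauss_mul hb (C := C) (hfc.comp (by fun_prop)) fun y => ?_
    exact (hf.norm_le _).trans (le_mul_of_one_le_right hC (by linarith [norm_nonneg y]))
  · exact (hG.mul ((hfd.comp (by fun_prop)).clm_apply (by fun_prop))).aestronglyMeasurable
  · have hτ' : t / 2 < τ := hτ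
    have h1 : ‖(((1 / (2 * √τ)) • y, 1) : SpaceTime n)‖ ≤ (c + 1) * (1 + ‖y‖) := by
      have hcτ : 1 / (2 * √τ) ≤ c := by
        rw [hc]
        exact one_div_le_one_div_of_le (by positivity)
          (mul_le_mul_of_nonneg_left (Real.sqrt_le_sqrt hτ'.le) (by norm_num))
      have hc0 : 0 ≤ c := by positivity
      rw [Prod.norm_def, norm_smul, Real.norm_of_nonneg (by positivity), norm_one]
      refine max_le ?_ ?_
      · calc _ ≤ c * ‖y‖ := by gcongr
          _ ≤ _ := by nlinarith [norm_nonneg y]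
      · nlinarith [norm_nonneg y, mul_nonneg hc0 (norm_nonneg y)]
    rw [norm_mul]
    calc _ ≤ ‖gauss (kReg ε / 4) y‖ * (C * ((c + 1) * (1 + ‖y‖))) := by
          gcongr
          refine (ContinuousLinearMap.le_opNorm _ _).trans ?_
          exact mul_le_mul (hf.norm_fderiv_le _) h1 (norm_nonneg _) hC
      _ = _ := by ring
  · exact (integrable_one_add_norm_mul_gauss hb).const_mul _
  · have hτ' : 0 < τ := lt_trans (by positivity) (show t / 2 < τ from hτ)
    have h1 : HasDerivAt (fun τ : ℝ => ((√τ • y, τ) : SpaceTime n))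
        ((1 / (2 * √τ)) • y, 1) τ :=
      ((Real.hasDerivAt_sqrt hτ'.ne').smul_const y).prodMk (hasDerivAt_id τ)
    exact (HasFDerivAt.comp_hasDerivAt (f := fun τ : ℝ => ((√τ • y, τ) : SpaceTime n)) τ
      (hd (√τ • y, τ)).hasFDerivAt h1).const_mul _

/-- Along the parabolic rescaling, the Gaussian mean of `f` has the Gaussian mean of
`(Δ + 𝐤 ∂ₜ) f` as its time derivative, up to the factor `𝐤`: the radial derivative produced by the
rescaling becomes the Laplacian after an integration by parts. -/
lemma hasDerivAt_gaussMean (hε : 0 < ε) {f : SpaceTime n → ℂ} {C : ℝ} (hf : HasBoundedJet f C)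
    {t : ℝ} (ht : 0 < t) :
    HasDerivAt (gaussMean ε f) ((kReg ε)⁻¹ * ∫ y : E n, gauss (kReg ε / 4) y *
      schrodingerOpTranspose ε f (√t • y, t)) t := by
  convert hasDerivAt_gaussMean_aux hε hf ht using 1
  have hst : 0 < √t := Real.sqrt_pos.2 ht
  have hb := kReg_div_four_re_pos hε
  have hC := hf.nonneg
  have hfd1 : ContDiff ℝ 1 (fderiv ℝ f) := hf.contDiff.fderiv_right (by norm_num)
  have hfd := hfd1.continuous
  have hfdd : Continuous (fderiv ℝ (fderiv ℝ f)) := hfd1.continuous_fderiv (by norm_num)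
  set b := kReg ε / 4 with hbdef
  -- the rescaled slice `h y = f (√t y, t)`
  set ι : E n →L[ℝ] SpaceTime n := √t • ContinuousLinearMap.inl ℝ (E n) ℝ with hι
  have hιn : ‖ι‖ ≤ √t := by
    rw [hι, norm_smul, Real.norm_of_nonneg hst.le]
    exact mul_le_of_le_one_right hst.le (ContinuousLinearMap.norm_inl_le_one ℝ (E n) ℝ)
  set h : E n → ℂ := fun y => f (√t • y, t) with hh
  have hin : ContDiff ℝ 2 (fun y : E n => ((√t • y, t) : SpaceTime n)) := by fun_prop
  have hhC : ContDiff ℝ 2 h := hf.contDiff.comp hin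
  have hder : ∀ y, HasFDerivAt (fun y : E n => ((√t • y, t) : SpaceTime n)) ι y := fun y => by
    have h1 := (ι.hasFDerivAt (x := y)).add_const ((0, t) : SpaceTime n)
    have h2 : (fun y : E n => ((√t • y, t) : SpaceTime n)) = fun y => ι y + (0, t) := by
      funext z; simp [hι]
    rw [h2]; exact h1
  have hh1 : ∀ y, fderiv ℝ h y = (fderiv ℝ f (√t • y, t)).comp ι := fun y =>
    (((hf.contDiff.differentiable (by norm_num)) _).hasFDerivAt.comp y (hder y)).fderiv
  have hh2 : ∀ y v w, fderiv ℝ (fderiv ℝ h) y v w =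
      fderiv ℝ (fderiv ℝ f) (√t • y, t) (ι v) (ι w) := fun y v w => by
    have hL : HasFDerivAt (fun y => (fderiv ℝ f (√t • y, t)).comp ι)
        (((ContinuousLinearMap.compL ℝ (E n) (SpaceTime n) ℂ).flip ι).comp
          ((fderiv ℝ (fderiv ℝ f) (√t • y, t)).comp ι)) y :=
      ((ContinuousLinearMap.compL ℝ (E n) (SpaceTime n) ℂ).flip ι).hasFDerivAt.comp y
        (((hfd1.differentiable (by norm_num)) _).hasFDerivAt.comp y (hder y))
    rw [funext hh1, hL.fderiv]
    simp
  have hB1 : ∀ y, ‖fderiv ℝ h y‖ ≤ C * √t + C * (√t * √t) := fun y => by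
    rw [hh1]
    refine (ContinuousLinearMap.opNorm_comp_le _ _).trans ?_
    have := mul_le_mul (hf.norm_fderiv_le (√t • y, t)) hιn (norm_nonneg _) hC
    have h0 : 0 ≤ C * (√t * √t) := by positivity
    linarith
  have hB2 : ∀ y, ‖fderiv ℝ (fderiv ℝ h) y‖ ≤ C * √t + C * (√t * √t) := fun y => by
    have h0 : 0 ≤ C * √t := by positivity
    refine ContinuousLinearMap.opNorm_le_bound₂ _ (by positivity) fun v w => ?_
    rw [hh2]
    refine (ContinuousLinearMap.le_opNorm₂ _ _ _).trans ?_
    have hv : ‖ι v‖ ≤ √t * ‖v‖ := (ι.le_opNorm v).trans (by gcongr)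
    have hw : ‖ι w‖ ≤ √t * ‖w‖ := (ι.le_opNorm w).trans (by gcongr)
    calc _ ≤ C * (√t * ‖v‖) * (√t * ‖w‖) := by
          gcongr
          exact hf.norm_fderiv_fderiv_le _
      _ = C * (√t * √t) * ‖v‖ * ‖w‖ := by ring
      _ ≤ _ := by gcongr; linarith
  have hrad := integral_gauss_mul_radial hb hhC hB1 hB2
  have hlap : ∀ y, ∑ i, fderiv ℝ (fderiv ℝ h) y (EuclideanSpace.basisFun (Fin n) ℝ i)
        (EuclideanSpace.basisFun (Fin n) ℝ i) =
      (t : ℂ) * spaceLap (fderiv ℝ (fderiv ℝ f) (√t • y, t)) := fun y => by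
    rw [spaceLap, Finset.mul_sum]
    refine Finset.sum_congr rfl fun i _ => ?_
    rw [hh2, hι]
    simp only [smul_apply, ContinuousLinearMap.inl_apply, map_smul,
      Complex.real_smul, ← mul_assoc]
    rw [← Complex.ofReal_mul, Real.mul_self_sqrt ht.le]
  have hradpt : ∀ y, fderiv ℝ h y y = (√t : ℂ) * fderiv ℝ f (√t • y, t) (y, 0) := fun y => by
    rw [hh1, hι]
    simp
  simp_rw [hlap, hradpt] at hrad
  have hlinC : ∀ y : E n, C ≤ C * (1 + ‖y‖) := fun y =>
    le_mul_of_one_le_right hC (by linarith [norm_nonneg y])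
  have hc0 : Continuous fun y : E n => ((√t • y, t) : SpaceTime n) := hin.continuous
  have hI1 : Integrable fun y : E n => gauss b y * fderiv ℝ f (√t • y, t) (y, 0) := by
    refine integrable_gauss_mul hb (C := C) ((hfd.comp hc0).clm_apply (by fun_prop)) fun y => ?_
    refine (ContinuousLinearMap.le_opNorm _ _).trans ?_
    refine mul_le_mul (hf.norm_fderiv_le _) ?_ (norm_nonneg _) hC
    simp [Prod.norm_def]
  have hI2 : Integrable fun y : E n => gauss b y * fderiv ℝ f (√t • y, t) (0, 1) := by
    refine integrable_gauss_mul hb (C := C) ((hfd.comp hc0).clm_apply (by fun_prop)) fun y => ?_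
    refine ((ContinuousLinearMap.le_opNorm _ _).trans ?_).trans (hlinC y)
    simpa [Prod.norm_def] using hf.norm_fderiv_le _
  have hI3 : Integrable fun y : E n =>
      gauss b y * spaceLap (fderiv ℝ (fderiv ℝ f) (√t • y, t)) := by
    refine integrable_gauss_mul hb (C := n * C)
      (continuous_spaceLap.comp (hfdd.comp hc0)) fun y => ?_
    refine (norm_spaceLap_le _).trans ?_
    rw [mul_assoc]
    exact mul_le_mul_of_nonneg_left ((hf.norm_fderiv_fderiv_le _).trans (hlinC y))
      (Nat.cast_nonneg n)
  have hl : ∀ y : E n, gauss b y * schrodingerOpTranspose ε f (√t • y, t) =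
      gauss b y * spaceLap (fderiv ℝ (fderiv ℝ f) (√t • y, t)) +
        kReg ε * (gauss b y * fderiv ℝ f (√t • y, t) (0, 1)) := fun y => by
    rw [schrodingerOpTranspose_eq hf.contDiff.contDiffAt]; ring
  have hr : ∀ y : E n, gauss b y * fderiv ℝ f (√t • y, t) ((1 / (2 * √t)) • y, 1) =
      ((1 / (2 * √t) : ℝ) : ℂ) * (gauss b y * fderiv ℝ f (√t • y, t) (y, 0)) +
        gauss b y * fderiv ℝ f (√t • y, t) (0, 1) := fun y => by
    rw [fderiv_spaceTime_apply]; ring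
  simp_rw [hl, hr]
  rw [integral_add hI3 (hI2.const_mul _), integral_add (hI1.const_mul _) hI2, integral_const_mul,
    integral_const_mul]
  have hs1 : ∀ y : E n, gauss b y * ((√t : ℂ) * fderiv ℝ f (√t • y, t) (y, 0)) =
      (√t : ℂ) * (gauss b y * fderiv ℝ f (√t • y, t) (y, 0)) := fun y => by ring
  have hs2 : ∀ y : E n, gauss b y * ((t : ℂ) * spaceLap (fderiv ℝ (fderiv ℝ f) (√t • y, t))) =
      (t : ℂ) * (gauss b y * spaceLap (fderiv ℝ (fderiv ℝ f) (√t • y, t))) := fun y => by ring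
  simp_rw [hs1, hs2] at hrad
  rw [integral_const_mul, integral_const_mul] at hrad
  have hk := kReg_ne_zero ε
  have hst' : (√t : ℂ) ≠ 0 := by exact_mod_cast hst.ne'
  have htt : (t : ℂ) = (√t : ℂ) * (√t : ℂ) := by
    rw [← Complex.ofReal_mul, Real.mul_self_sqrt ht.le]
  rw [htt, hbdef] at hrad
  push_cast
  field_simp
  set I1 := ∫ y : E n, gauss b y * spaceLap (fderiv ℝ (fderiv ℝ f) (√t • y, t))
  set I2 := ∫ y : E n, gauss b y * fderiv ℝ f (√t • y, t) (y, 0)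
  have hrad' : kReg ε / 2 * I2 = (√t : ℂ) * I1 := by
    apply mul_left_cancel₀ hst'
    linear_combination hrad
  linear_combination (-2 : ℂ) * hrad'

/-- A function that vanishes at late times has vanishing transposed operator there. -/
lemma schrodingerOpTranspose_eq_zero {f : SpaceTime n → ℂ} {T : ℝ}
    (hT : ∀ x t, T < t → f (x, t) = 0) {x : E n} {t : ℝ} (ht : T < t) :
    schrodingerOpTranspose ε f (x, t) = 0 := by
  have h1 : (fun y : E n => f (y, t)) = fun _ => 0 := funext fun y => hT y t ht
  have h2 : (fun τ : ℝ => f (x, τ)) =ᶠ[nhds t] fun _ => 0 := by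
    filter_upwards [Ioi_mem_nhds ht] with τ hτ using hT x τ hτ
  rw [schrodingerOpTranspose]
  simp only [h1, h2.deriv_eq]
  simp

lemma integrable_eMinus_mul (hε : 0 < ε) {f : SpaceTime n → ℂ} {C T : ℝ} (hf : HasBoundedJet f C)
    (hT : ∀ x t, T < t → f (x, t) = 0) :
    Integrable (fun p => eMinus ε p * schrodingerOpTranspose ε f p) := by
  have h1 : IntegrableOn (fun p => eMinus ε p * schrodingerOpTranspose ε f p)
      (Set.univ ×ˢ Set.Iic T) :=
    (integrableOn_eMinus hε n T).mul_bdd (c := (n + ‖kReg ε‖) * C)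
      (continuous_schrodingerOpTranspose ε hf.contDiff).aestronglyMeasurable
      (Filter.Eventually.of_forall fun p => hf.norm_schrodingerOpTranspose_le ε p)
  rw [← integrableOn_univ]
  refine h1.of_forall_sdiff_eq_zero MeasurableSet.univ ?_
  rintro ⟨x, t⟩ ⟨_, h⟩
  have ht : T < t := not_le.1 fun h' => h ⟨trivial, h'⟩
  simp only [schrodingerOpTranspose_eq_zero hT ht, mul_zero]

/-- The kernel is a fundamental solution, tested on functions that are bounded together with
their derivatives of order at most two and vanish at late times; compact support in space is not
needed. -/
theorem integral_eMinus_mul_schrodingerOpTranspose (hε : 0 < ε) {f : SpaceTime n → ℂ} {C T : ℝ}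
    (hf : HasBoundedJet f C) (hT : ∀ x t, T < t → f (x, t) = 0) :
    ∫ p, eMinus ε p * schrodingerOpTranspose ε f p = f (0, 0) := by
  have hint := integrable_eMinus_mul hε hf hT
  have hk := kReg_ne_zero ε
  have hA := gaussConst_ne_zero ε n
  rw [Measure.volume_eq_prod] at hint ⊢
  rw [integral_prod_symm _ hint]
  have hslice := hint.integral_prod_right
  -- the inner integral is a multiple of the time derivative of the Gaussian mean
  have hinner : ∀ t, 0 < t → ∫ x : E n, eMinus ε (x, t) * schrodingerOpTranspose ε f (x, t) =
      gaussConst ε n * ∫ y : E n, gauss (kReg ε / 4) y *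
        schrodingerOpTranspose ε f (√t • y, t) := fun t ht =>
    integral_eMinus_mul ht fun x => schrodingerOpTranspose ε f (x, t)
  have hzero : ∀ t, t ∉ Set.Ioi (0 : ℝ) →
      ∫ x : E n, eMinus ε (x, t) * schrodingerOpTranspose ε f (x, t) = 0 := fun t ht => by
    have : ∀ x : E n, eMinus ε (x, t) = 0 := fun x => eMinus_of_nonpos (not_lt.1 ht)
    simp [this]
  rw [← setIntegral_eq_integral_of_forall_compl_eq_zero hzero]
  have hder : ∀ t ∈ Set.Ioi (0 : ℝ), HasDerivAt (fun t => gaussConst ε n * kReg ε * gaussMean ε f t)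
      (∫ x : E n, eMinus ε (x, t) * schrodingerOpTranspose ε f (x, t)) t := fun t ht => by
    have h1 := (hasDerivAt_gaussMean hε hf ht).const_mul (gaussConst ε n * kReg ε)
    rw [hinner t ht]
    have hv : ∀ I : ℂ, gaussConst ε n * kReg ε * ((kReg ε)⁻¹ * I) = gaussConst ε n * I :=
      fun I => by rw [mul_assoc, mul_inv_cancel_left₀ hk]
    rw [hv] at h1
    exact h1
  -- the boundary value at `t = ∞` vanishes, and the one at `t = 0` is the value at the pole
  have hlim : Filter.Tendsto (fun t => gaussConst ε n * kReg ε * gaussMean ε f t) Filter.atTop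
      (nhds 0) := by
    refine tendsto_const_nhds.congr' ?_
    filter_upwards [Filter.eventually_gt_atTop T] with t ht
    simp [gaussMean, hT _ t ht]
  rw [integral_Ioi_of_hasDerivAt_of_tendsto
    ((continuous_const.mul (continuous_gaussMean hε hf)).continuousWithinAt) hder
    hslice.integrableOn hlim]
  have h0 : gaussMean ε f 0 = (∫ y : E n, gauss (kReg ε / 4) y) * f (0, 0) := by
    simp only [gaussMean, Real.sqrt_zero, zero_smul]
    rw [integral_mul_const]
  change 0 - gaussConst ε n * kReg ε * gaussMean ε f 0 = f (0, 0)
  rw [h0]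
  linear_combination f (0, 0) * integral_gauss_kReg (n := n) hε

end Core

/-! ### The kernel solves the equation at positive times -/

section Equation

variable {n : ℕ} {ε : ℝ}

lemma contDiff_gauss (b : ℂ) : ContDiff ℝ ∞ (gauss b : E n → ℂ) := by
  have h1 : ContDiff ℝ ∞ (fun y : E n => ((‖y‖ ^ 2 : ℝ) : ℂ)) :=
    Complex.ofRealCLM.contDiff.comp (contDiff_id.norm_sq ℝ)
  exact (contDiff_const.mul h1).neg.cexp

lemma laplacian_gauss (b : ℂ) (y : E n) :
    Laplacian.laplacian (gauss b : E n → ℂ) y =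
      (4 * b ^ 2 * ((‖y‖ ^ 2 : ℝ) : ℂ) - 2 * b * n) * gauss b y := by
  set e := EuclideanSpace.basisFun (Fin n) ℝ with he
  rw [InnerProductSpace.laplacian_eq_iteratedFDeriv_orthonormalBasis _ e]
  have h2 : ∀ i, iteratedFDeriv ℝ 2 (gauss b : E n → ℂ) y ![e i, e i] =
      (4 * b ^ 2 * (((inner ℝ y (e i)) ^ 2 : ℝ) : ℂ) - 2 * b) * gauss b y := fun i => by
    rw [iteratedFDeriv_two_apply]
    have hd : DifferentiableAt ℝ (fderiv ℝ (gauss b : E n → ℂ)) y :=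
      (((contDiff_gauss b).fderiv_right (m := 1) (by norm_cast)).differentiable (by norm_num)) y
    have h3 : fderiv ℝ (fun z => fderiv ℝ (gauss b : E n → ℂ) z (e i)) y (e i) =
        fderiv ℝ (fderiv ℝ (gauss b : E n → ℂ)) y (e i) (e i) := by
      rw [(hd.hasFDerivAt.clm_apply (hasFDerivAt_const (e i) y)).fderiv]; simp
    have h4 : HasFDerivAt (fun z : E n => ((inner ℝ z (e i) : ℝ) : ℂ))
        (Complex.ofRealCLM.comp (innerSL ℝ (e i))) y := by
      have := (Complex.ofRealCLM.comp (innerSL ℝ (e i))).hasFDerivAt (x := y)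
      refine this.congr_of_eventuallyEq (Filter.Eventually.of_forall fun z => ?_)
      simp [real_inner_comm]
    have h5 := (h4.mul (hasFDerivAt_gauss b y)).const_mul (-(2 * b))
    have h6 : (fun z : E n => fderiv ℝ (gauss b : E n → ℂ) z (e i)) =
        fun z => -(2 * b) * (((inner ℝ z (e i) : ℝ) : ℂ) * gauss b z) :=
      funext fun z => fderiv_gauss_apply b z (e i)
    change fderiv ℝ (fderiv ℝ (gauss b : E n → ℂ)) y (e i) (e i) = _
    rw [← h3, h6]
    erw [h5.fderiv]
    simp
    ring
  simp_rw [h2]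
  rw [← Finset.sum_mul, Finset.sum_sub_distrib, ← Finset.mul_sum, ← Complex.ofReal_sum]
  have h8 : ∑ i, inner ℝ y (e i) ^ 2 = ‖y‖ ^ 2 := by
    have := e.sum_sq_norm_inner_left y
    simpa using this
  rw [h8, Finset.sum_const, Finset.card_univ, Fintype.card_fin, nsmul_eq_mul]
  ring

lemma contDiffAt_eMinus {p : SpaceTime n} (hp : 0 < p.2) :
    ContDiffAt ℝ ∞ (eMinus ε : SpaceTime n → ℂ) p :=
  (contDiffOn_eMinus ε n).contDiffAt (isOpen_pos_time.mem_nhds hp)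

lemma schrodingerOp_eMinus {p : SpaceTime n} (hp : 0 < p.2) :
    schrodingerOp ε (eMinus ε) p = 0 := by
  obtain ⟨x, t⟩ := p
  have ht : 0 < t := hp
  have htC : (t : ℂ) ≠ 0 := by exact_mod_cast ht.ne'
  set b := kReg ε / (4 * t) with hb
  set c := gaussConst ε n * (((√t ^ n : ℝ) : ℂ))⁻¹ with hc
  have h1 : (fun y : E n => eMinus ε (y, t)) = c • (gauss b : E n → ℂ) := by
    funext y
    rw [eMinus_of_pos (p := (y, t)) ht, Pi.smul_apply, smul_eq_mul, gauss, hb]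
    congr 3
    push_cast
    field_simp
  have h2 : Laplacian.laplacian (fun y : E n => eMinus ε (y, t)) x =
      (4 * b ^ 2 * ((‖x‖ ^ 2 : ℝ) : ℂ) - 2 * b * n) * eMinus ε (x, t) := by
    rw [h1, InnerProductSpace.laplacian_smul c ((contDiff_gauss b).of_le (by norm_cast)).contDiffAt,
      laplacian_gauss, congrFun h1 x |>.trans rfl, Pi.smul_apply, smul_eq_mul, smul_eq_mul]
    ring
  have h3 : HasDerivAt (fun τ : ℝ => eMinus ε (x, τ))
      (eMinus ε (x, t) * (-((n : ℂ) / 2 * ((t⁻¹ : ℝ) : ℂ)) -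
        kReg ε / 4 * ((-(‖x‖ ^ 2) / t ^ 2 : ℝ) : ℂ))) t := by
    have h4 : HasDerivAt (fun τ : ℝ => ((Real.log τ : ℝ) : ℂ)) ((t⁻¹ : ℝ) : ℂ) t :=
      (Real.hasDerivAt_log ht.ne').ofReal_comp
    have h5 : HasDerivAt (fun τ : ℝ => ((‖x‖ ^ 2 / τ : ℝ) : ℂ)) ((-(‖x‖ ^ 2) / t ^ 2 : ℝ) : ℂ) t := by
      have := ((hasDerivAt_const t (‖x‖ ^ 2)).div (hasDerivAt_id t) ht.ne').ofReal_comp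
      simpa using this
    have h6 := (((h4.const_mul ((n : ℂ) / 2)).const_sub (Complex.log (gaussConst ε n))).sub
      (h5.const_mul (kReg ε / 4))).cexp
    have h7 : (fun τ : ℝ => eMinus ε (x, τ)) =ᶠ[nhds t] fun τ => Complex.exp (phase ε (x, τ)) := by
      filter_upwards [Ioi_mem_nhds ht] with τ hτ using eMinus_eq_exp (p := (x, τ)) hτ
    refine HasDerivAt.congr_of_eventuallyEq ?_ h7
    rw [eMinus_eq_exp (p := (x, t)) ht]
    exact h6
  rw [schrodingerOp, h2, h3.deriv, hb]
  push_cast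
  field_simp
  ring

end Equation

/-! ### Termwise differentiation of series -/

section SmoothSeries

variable {ι V W : Type} [NormedAddCommGroup V] [NormedSpace ℝ V] [NormedAddCommGroup W]
  [NormedSpace ℝ W] [CompleteSpace W]

/-- On an open connected set, a series whose derivatives of all orders converge normally can be
differentiated term by term. -/
lemma hasFDerivAt_tsum_of_bounds {f : ι → V → W} {U : Set V} (hU : IsOpen U)
    (hc : IsPreconnected U) (hf : ∀ i, ContDiffOn ℝ ∞ (f i) U)
    (hb : ∀ k : ℕ, ∃ u : ι → ℝ, Summable u ∧
      ∀ i, ∀ x ∈ U, ‖iteratedFDeriv ℝ k (f i) x‖ ≤ u i) {x : V} (hx : x ∈ U) :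
    HasFDerivAt (fun y => ∑' i, f i y) (∑' i, fderiv ℝ (f i) x) x := by
  obtain ⟨u, hu, hfu⟩ := hb 1
  obtain ⟨u0, hu0, hfu0⟩ := hb 0
  refine hasFDerivAt_tsum_of_isPreconnected hu hU hc
    (fun i y hy => (((hf i).contDiffAt (hU.mem_nhds hy)).differentiableAt
      (by norm_num)).hasFDerivAt)
    (fun i y hy => ?_) hx ?_ hx
  · rw [← norm_iteratedFDeriv_one]; exact hfu i y hy
  · refine hu0.of_norm_bounded fun i => ?_
    rw [← norm_iteratedFDeriv_zero (𝕜 := ℝ)]; exact hfu0 i x hx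

lemma hasSum_fderiv_of_bounds {f : ι → V → W} {U : Set V} (hU : IsOpen U)
    (hc : IsPreconnected U) (hf : ∀ i, ContDiffOn ℝ ∞ (f i) U)
    (hb : ∀ k : ℕ, ∃ u : ι → ℝ, Summable u ∧
      ∀ i, ∀ x ∈ U, ‖iteratedFDeriv ℝ k (f i) x‖ ≤ u i) {x : V} (hx : x ∈ U) :
    HasSum (fun i => fderiv ℝ (f i) x) (fderiv ℝ (fun y => ∑' i, f i y) x) := by
  obtain ⟨u, hu, hub⟩ := hb 1
  have hs : Summable fun i => fderiv ℝ (f i) x :=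
    hu.of_norm_bounded fun i => by rw [← norm_iteratedFDeriv_one]; exact hub i x hx
  rw [(hasFDerivAt_tsum_of_bounds hU hc hf hb hx).fderiv]
  exact hs.hasSum

lemma hasSum_fderiv_fderiv_of_bounds {f : ι → V → W} {U : Set V} (hU : IsOpen U)
    (hc : IsPreconnected U) (hf : ∀ i, ContDiffOn ℝ ∞ (f i) U)
    (hb : ∀ k : ℕ, ∃ u : ι → ℝ, Summable u ∧
      ∀ i, ∀ x ∈ U, ‖iteratedFDeriv ℝ k (f i) x‖ ≤ u i) {x : V} (hx : x ∈ U) :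
    HasSum (fun i => fderiv ℝ (fderiv ℝ (f i)) x)
      (fderiv ℝ (fderiv ℝ (fun y => ∑' i, f i y)) x) := by
  have hb' : ∀ k : ℕ, ∃ u : ι → ℝ, Summable u ∧
      ∀ i, ∀ x ∈ U, ‖iteratedFDeriv ℝ k (fderiv ℝ (f i)) x‖ ≤ u i := fun k => by
    obtain ⟨u, hu, hub⟩ := hb (k + 1)
    exact ⟨u, hu, fun i x hx => by rw [norm_iteratedFDeriv_fderiv]; exact hub i x hx⟩
  have hev : fderiv ℝ (fun y => ∑' i, f i y) =ᶠ[nhds x] fun y => ∑' i, fderiv ℝ (f i) y := by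
    filter_upwards [hU.mem_nhds hx] with y hy
    exact (hasFDerivAt_tsum_of_bounds hU hc hf hb hy).fderiv
  rw [hev.fderiv_eq]
  exact hasSum_fderiv_of_bounds hU hc (f := fun i => fderiv ℝ (f i))
    (fun i => (hf i).fderiv_of_isOpen hU (by norm_cast)) hb' hx

/-- The target varies in the statement because the induction passes to the series of derivatives. -/
lemma contDiffOn_nat_tsum_of_bounds (n : ℕ) : ∀ {W : Type} [NormedAddCommGroup W]
    [NormedSpace ℝ W] [CompleteSpace W] {f : ι → V → W} {U : Set V}, IsOpen U →
    IsPreconnected U → (∀ i, ContDiffOn ℝ ∞ (f i) U) →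
    (∀ k : ℕ, ∃ u : ι → ℝ, Summable u ∧
      ∀ i, ∀ x ∈ U, ‖iteratedFDeriv ℝ k (f i) x‖ ≤ u i) →
    ContDiffOn ℝ n (fun y => ∑' i, f i y) U := by
  induction n with
  | zero =>
    intro W _ _ _ f U hU hc hf hb
    obtain ⟨u0, hu0, hfu0⟩ := hb 0
    rw [Nat.cast_zero, contDiffOn_zero]
    refine continuousOn_tsum (fun i => (hf i).continuousOn) hu0 fun i x hx => ?_
    rw [← norm_iteratedFDeriv_zero (𝕜 := ℝ)]; exact hfu0 i x hx
  | succ n ih =>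
    intro W _ _ _ f U hU hc hf hb
    rw [Nat.cast_succ, contDiffOn_succ_iff_fderiv_of_isOpen hU]
    have hd := fun x (hx : x ∈ U) => hasFDerivAt_tsum_of_bounds hU hc hf hb hx
    refine ⟨fun x hx => (hd x hx).differentiableAt.differentiableWithinAt, by simp, ?_⟩
    refine (ih (f := fun i => fderiv ℝ (f i)) hU hc
      (fun i => (hf i).fderiv_of_isOpen hU (by norm_cast)) fun k => ?_).congr
      fun x hx => (hd x hx).fderiv
    obtain ⟨u, hu, hfu⟩ := hb (k + 1)
    exact ⟨u, hu, fun i x hx => by rw [norm_iteratedFDeriv_fderiv]; exact hfu i x hx⟩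

lemma contDiffOn_tsum_of_bounds {f : ι → V → W} {U : Set V} (hU : IsOpen U)
    (hc : IsPreconnected U) (hf : ∀ i, ContDiffOn ℝ ∞ (f i) U)
    (hb : ∀ k : ℕ, ∃ u : ι → ℝ, Summable u ∧
      ∀ i, ∀ x ∈ U, ‖iteratedFDeriv ℝ k (f i) x‖ ≤ u i) :
    ContDiffOn ℝ ∞ (fun y => ∑' i, f i y) U :=
  contDiffOn_infty.2 fun n => contDiffOn_nat_tsum_of_bounds n hU hc hf hb

end SmoothSeries

/-! ### Decay of the translates of the kernel and of their derivatives -/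

section Decay

variable {n : ℕ} {ε : ℝ}

/-- A compact box in the half-space of positive times. -/
def timeBox (n : ℕ) (R a b : ℝ) : Set (SpaceTime n) := Metric.closedBall 0 R ×ˢ Set.Icc a b

lemma isCompact_timeBox (R a b : ℝ) : IsCompact (timeBox n R a b) :=
  (isCompact_closedBall _ _).prod isCompact_Icc

lemma timeBox_subset {R a b : ℝ} (ha : 0 < a) : timeBox n R a b ⊆ {p | 0 < p.2} :=
  fun _ hp => ha.trans_le hp.2.1

/-- At positive times the translates of the kernel decay to every polynomial order in the
translation vector, locally uniformly. -/
lemma exists_norm_eMinus_sub_mul_pow_le (hε : 0 < ε) {R a b : ℝ} (hR : 0 ≤ R) (ha : 0 < a) (j : ℕ) :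
    ∃ C : ℝ, 0 ≤ C ∧ ∀ (w : E n), ∀ p ∈ timeBox n R a b,
      ‖eMinus ε (p.1 - w, p.2)‖ * (1 + ‖w‖) ^ (n + 2 * j) ≤ C := by
  obtain ⟨C, hC, hb⟩ := exists_norm_eMinus_mul_pow_le hε n j
  set q := n + 2 * j with hq
  set A := ‖gaussConst ε n‖ * (√a ^ n)⁻¹ with hA
  have hA0 : 0 ≤ A := by positivity
  rcases le_or_gt a b with hab | hab
  swap
  · exact ⟨0, le_rfl, fun w p hp => absurd (hp.2.1.trans hp.2.2) (not_le.2 hab)⟩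
  have hb0 : 0 < b := ha.trans_le hab
  refine ⟨(1 + R) ^ q * (2 ^ (q - 1) * (A + C * b ^ j)), by positivity, fun w p hp => ?_⟩
  have hp2 : 0 < p.2 := timeBox_subset ha hp
  have hpR : ‖p.1‖ ≤ R := by simpa using hp.1
  set e := ‖eMinus ε (p.1 - w, p.2)‖ with he
  set y := ‖p.1 - w‖ with hy
  have h1 : 1 + ‖w‖ ≤ (1 + R) * (1 + y) := by
    have : ‖w‖ ≤ ‖p.1‖ + y := by rw [hy, norm_sub_rev]; exact norm_le_insert' w p.1
    nlinarith [norm_nonneg (p.1 - w)]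
  have h2 : e ≤ A := by
    refine (norm_eMinus_le hε (p := (p.1 - w, p.2)) hp2).trans ?_
    rw [hA]
    have hsa : 0 < √a := Real.sqrt_pos.2 ha
    have hsab : √a ≤ √p.2 := Real.sqrt_le_sqrt hp.2.1
    show ‖gaussConst ε n‖ * (√p.2 ^ n)⁻¹ ≤ _
    gcongr
  have h3 : e * y ^ q ≤ C * b ^ j :=
    (hb (p.1 - w) p.2 hp2.le).trans (by gcongr; exact hp.2.2)
  have hy0 : 0 ≤ y := norm_nonneg _
  have he0 : 0 ≤ e := norm_nonneg _
  calc e * (1 + ‖w‖) ^ q ≤ e * ((1 + R) * (1 + y)) ^ q := by gcongr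
    _ = (1 + R) ^ q * (e * (1 + y) ^ q) := by rw [mul_pow]; ring
    _ ≤ (1 + R) ^ q * (e * (2 ^ (q - 1) * (1 ^ q + y ^ q))) := by
        gcongr
        exact add_pow_le zero_le_one hy0 q
    _ = (1 + R) ^ q * (2 ^ (q - 1) * (e + e * y ^ q)) := by rw [one_pow]; ring
    _ ≤ _ := by gcongr

lemma uniqueDiffOn_pos_time : UniqueDiffOn ℝ {p : SpaceTime n | 0 < p.2} :=
  isOpen_pos_time.uniqueDiffOn

lemma exists_norm_iteratedFDerivWithin_le {W : Type} [NormedAddCommGroup W] [NormedSpace ℝ W]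
    {f : SpaceTime n → W} (hf : ContDiffOn ℝ ∞ f {p | 0 < p.2}) {R a b : ℝ} (ha : 0 < a) (i : ℕ) :
    ∃ C : ℝ, ∀ p ∈ timeBox n R a b, ‖iteratedFDerivWithin ℝ i f {p | 0 < p.2} p‖ ≤ C :=
  (isCompact_timeBox R a b).exists_bound_of_continuousOn
    ((hf.continuousOn_iteratedFDerivWithin (by exact_mod_cast le_top) uniqueDiffOn_pos_time).mono
      (timeBox_subset ha))

/-- The exponent of a translate of the kernel is a quadratic polynomial in the translation
vector. -/
lemma phase_sub (w : E n) (p : SpaceTime n) :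
    phase ε (p.1 - w, p.2) = phase ε p +
      ((((p.2⁻¹ : ℝ) : ℂ) * (kReg ε / 2)) • (Complex.ofRealCLM.comp (innerSL ℝ p.1))) w +
      (‖w‖ ^ 2 : ℝ) • (-(kReg ε / 4) * ((p.2⁻¹ : ℝ) : ℂ)) := by
  simp only [phase, norm_sub_sq_real]
  simp
  ring

lemma contDiffOn_inv_time :
    ContDiffOn ℝ ∞ (fun p : SpaceTime n => ((p.2⁻¹ : ℝ) : ℂ)) {p | 0 < p.2} :=
  Complex.ofRealCLM.contDiff.comp_contDiffOn
    (contDiff_snd.contDiffOn.inv fun _ hp => ne_of_gt hp)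

/-- The derivatives of the exponent of a translate grow at most quadratically in the translation
vector. -/
lemma exists_norm_iteratedFDerivWithin_phase_sub_le {R a b : ℝ} (ha : 0 < a) (i : ℕ) :
    ∃ B : ℝ, 0 ≤ B ∧ ∀ (w : E n), ∀ p ∈ timeBox n R a b,
      ‖iteratedFDerivWithin ℝ i (fun p : SpaceTime n => phase ε (p.1 - w, p.2)) {p | 0 < p.2} p‖ ≤
        B * (1 + ‖w‖) ^ 2 := by
  set V := {p : SpaceTime n | 0 < p.2} with hV
  set f1 : SpaceTime n → E n →L[ℝ] ℂ := fun p =>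
    (((p.2⁻¹ : ℝ) : ℂ) * (kReg ε / 2)) • (Complex.ofRealCLM.comp (innerSL ℝ p.1)) with hf1
  set f2 : SpaceTime n → ℂ := fun p => -(kReg ε / 4) * ((p.2⁻¹ : ℝ) : ℂ) with hf2
  have hc0 := contDiffOn_phase ε n
  have hc1 : ContDiffOn ℝ ∞ f1 V := by
    refine (contDiffOn_inv_time.mul contDiffOn_const).smul (ContDiff.contDiffOn ?_)
    exact contDiff_const.clm_comp ((innerSL ℝ).contDiff.comp contDiff_fst)
  have hc2 : ContDiffOn ℝ ∞ f2 V := contDiffOn_const.mul contDiffOn_inv_time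
  obtain ⟨B0, hB0⟩ := exists_norm_iteratedFDerivWithin_le hc0 (R := R) (b := b) ha i
  obtain ⟨B1, hB1⟩ := exists_norm_iteratedFDerivWithin_le hc1 (R := R) (b := b) ha i
  obtain ⟨B2, hB2⟩ := exists_norm_iteratedFDerivWithin_le hc2 (R := R) (b := b) ha i
  refine ⟨|B0| + |B1| + |B2|, by positivity, fun w p hp => ?_⟩
  have hpV : p ∈ V := timeBox_subset ha hp
  have hc1w : ContDiffOn ℝ ∞ (fun p => f1 p w) V := hc1.clm_apply contDiffOn_const
  have heq : (fun p : SpaceTime n => phase ε (p.1 - w, p.2)) =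
      (phase ε + fun p => f1 p w) + (‖w‖ ^ 2 : ℝ) • f2 := funext fun p => phase_sub w p
  have hle : ((i : ℕ∞) : WithTop ℕ∞) ≤ ∞ := by exact_mod_cast le_top
  have hU : UniqueDiffOn ℝ V := uniqueDiffOn_pos_time
  have k0 : ContDiffWithinAt ℝ i (phase ε) V p := (hc0 p hpV).of_le hle
  have k1 : ContDiffWithinAt ℝ i (fun p => f1 p w) V p := (hc1w p hpV).of_le hle
  have k2 : ContDiffWithinAt ℝ i f2 V p := (hc2 p hpV).of_le hle
  have k01 : ContDiffWithinAt ℝ i (phase ε + fun p => f1 p w) V p := k0.add k1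
  have k2' : ContDiffWithinAt ℝ i ((‖w‖ ^ 2 : ℝ) • f2) V p :=
    k2.const_smul (‖w‖ ^ 2)
  rw [heq, iteratedFDerivWithin_add_apply k01 k2' hU hpV,
    iteratedFDerivWithin_add_apply k0 k1 hU hpV,
    iteratedFDerivWithin_const_smul_apply k2 hU hpV]
  have n0 := (hB0 p hp).trans (le_abs_self B0)
  have n1 : ‖iteratedFDerivWithin ℝ i (fun p => f1 p w) V p‖ ≤ ‖w‖ * |B1| :=
    (norm_iteratedFDerivWithin_clm_apply_const (hc1 p hpV) hU hpV hle).trans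
      (by gcongr; exact (hB1 p hp).trans (le_abs_self B1))
  have n2 : ‖(‖w‖ ^ 2 : ℝ) • iteratedFDerivWithin ℝ i f2 V p‖ ≤ ‖w‖ ^ 2 * |B2| := by
    rw [norm_smul, Real.norm_of_nonneg (by positivity)]
    gcongr
    exact (hB2 p hp).trans (le_abs_self B2)
  refine (norm_add₃_le).trans ((add_le_add (add_le_add n0 n1) n2).trans ?_)
  have hw := norm_nonneg w
  have a0 := abs_nonneg B0
  have a1 := abs_nonneg B1
  have a2 := abs_nonneg B2
  nlinarith [mul_nonneg hw a0, mul_nonneg hw a1, mul_nonneg hw a2, mul_nonneg (sq_nonneg ‖w‖) a0,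
    mul_nonneg (sq_nonneg ‖w‖) a1]

/-- All real derivatives of the exponential are bounded by multiples of the exponential itself, so
that Faà di Bruno estimates for `exp ∘ phase` keep the decay of the kernel as a factor. -/
lemma exists_norm_iteratedFDeriv_cexp_le (k : ℕ) :
    ∃ C : ℝ, 0 ≤ C ∧ ∀ i ≤ k, ∀ w : ℂ, ‖iteratedFDeriv ℝ i Complex.exp w‖ ≤ C * ‖Complex.exp w‖ := by
  refine ⟨∑ i ∈ Finset.range (k + 1), ‖iteratedFDeriv ℝ i Complex.exp 0‖, by positivity,
    fun i hi w => ?_⟩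
  have h1 : iteratedFDeriv ℝ i Complex.exp w =
      Complex.exp w • iteratedFDeriv ℝ i Complex.exp 0 := by
    have h2 := iteratedFDeriv_comp_add_right (𝕜 := ℝ) (f := Complex.exp) i w 0
    rw [zero_add] at h2
    rw [← h2]
    have h3 : (fun z => Complex.exp (z + w)) = Complex.exp w • Complex.exp := by
      funext z; rw [Complex.exp_add, Pi.smul_apply, smul_eq_mul, mul_comm]
    rw [h3, iteratedFDeriv_const_smul_apply]
    exact (Complex.contDiff_exp (𝕜 := ℝ)).contDiffAt
  rw [h1, norm_smul, mul_comm]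
  gcongr
  exact Finset.single_le_sum (f := fun i => ‖iteratedFDeriv ℝ i Complex.exp 0‖)
    (fun _ _ => norm_nonneg _) (Finset.mem_range.2 (Nat.lt_succ_of_le hi))

/-- The derivatives of the translates of the kernel decay polynomially in the translation vector,
locally uniformly at positive times. -/
lemma exists_norm_iteratedFDeriv_eMinus_sub_le (hε : 0 < ε) {R a b : ℝ} (hR : 0 ≤ R) (ha : 0 < a)
    (k : ℕ) :
    ∃ C : ℝ, ∀ (w : E n), ∀ p ∈ timeBox n R a b,
      ‖iteratedFDeriv ℝ k (fun p : SpaceTime n => eMinus ε (p.1 - w, p.2)) p‖ ≤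
        C * ((1 + ‖w‖) ^ (n + 2))⁻¹ := by
  set V := {p : SpaceTime n | 0 < p.2} with hV
  obtain ⟨C1, hC1, hexp⟩ := exists_norm_iteratedFDeriv_cexp_le k
  choose B hB0 hB using fun i =>
    exists_norm_iteratedFDerivWithin_phase_sub_le (n := n) (ε := ε) (R := R) (b := b) ha i
  -- the chain rule costs `2k` powers of `1 + ‖w‖`, which the decay of the kernel absorbs
  obtain ⟨C2, hC2, hdec⟩ := exists_norm_eMinus_sub_mul_pow_le (n := n) (b := b) hε hR ha (k + 1)
  set D := 1 + ∑ i ∈ Finset.range (k + 1), B i with hD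
  have hsum : 0 ≤ ∑ i ∈ Finset.range (k + 1), B i := Finset.sum_nonneg fun i _ => hB0 i
  have hD1 : 1 ≤ D := by linarith
  refine ⟨k.factorial * C1 * D ^ k * C2, fun w p hp => ?_⟩
  have hpV : p ∈ V := timeBox_subset ha hp
  set M := 1 + ‖w‖ with hM
  have hM1 : 1 ≤ M := by linarith [norm_nonneg w]
  have hphase : ContDiffOn ℝ ∞ (fun p : SpaceTime n => phase ε (p.1 - w, p.2)) V :=
    (contDiffOn_phase ε n).comp (g := phase ε) (f := fun p : SpaceTime n => (p.1 - w, p.2))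
      (ContDiff.contDiffOn (by fun_prop)) fun p hp => hp
  have heq : Set.EqOn (fun p : SpaceTime n => eMinus ε (p.1 - w, p.2))
      (Complex.exp ∘ fun p : SpaceTime n => phase ε (p.1 - w, p.2)) V :=
    fun p hp => eMinus_eq_exp (p := (p.1 - w, p.2)) hp
  rw [← iteratedFDerivWithin_of_isOpen (s := V) k isOpen_pos_time hpV,
    iteratedFDerivWithin_congr heq hpV]
  have hcomp := norm_iteratedFDerivWithin_comp_le (n := k) (N := ∞) (g := Complex.exp) (t := Set.univ)
    (C := C1 * ‖eMinus ε (p.1 - w, p.2)‖) (D := D * M ^ 2)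
    (Complex.contDiff_exp (𝕜 := ℝ)).contDiffOn hphase (by exact_mod_cast le_top)
    uniqueDiffOn_univ uniqueDiffOn_pos_time (Set.mapsTo_univ _ _) hpV
    (fun i hi => by
      rw [iteratedFDerivWithin_univ, eMinus_eq_exp (p := (p.1 - w, p.2)) hpV]
      exact hexp i hi _)
    (fun i h1 hi => by
      refine (hB i w p hp).trans ?_
      have hBD : B i ≤ D := by
        have := Finset.single_le_sum (f := B) (fun i _ => hB0 i)
          (Finset.mem_range.2 (Nat.lt_succ_of_le hi))
        linarith
      calc B i * M ^ 2 ≤ D * M ^ 2 := by gcongr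
        _ ≤ (D * M ^ 2) ^ i := le_self_pow₀ (one_le_mul_of_one_le_of_one_le hD1
            (one_le_pow₀ hM1)) (by omega))
  refine hcomp.trans ?_
  rw [← div_eq_mul_inv, le_div_iff₀ (by positivity)]
  have h5 := hdec w p hp
  calc _ = k.factorial * C1 * D ^ k * (‖eMinus ε (p.1 - w, p.2)‖ * M ^ (n + 2 * (k + 1))) := by
        rw [mul_pow, ← pow_mul]; ring
    _ ≤ _ := by gcongr

/-- Down to time zero, the translates of the kernel by long vectors decay polynomially. -/
lemma exists_norm_eMinus_sub_le (hε : 0 < ε) {R T : ℝ} (hR : 0 < R) (hT : 0 ≤ T) :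
    ∃ C : ℝ, 0 ≤ C ∧ ∀ (w : E n), 2 * R ≤ ‖w‖ → ∀ p : SpaceTime n, ‖p.1‖ ≤ R → p.2 ≤ T →
      ‖eMinus ε (p.1 - w, p.2)‖ ≤ C * (‖w‖ ^ (n + 2))⁻¹ := by
  obtain ⟨C, hC, hb⟩ := exists_norm_eMinus_mul_pow_le hε n 1
  refine ⟨C * T * 2 ^ (n + 2), by positivity, fun w hw p hp hpT => ?_⟩
  have hw0 : 0 < ‖w‖ := by linarith
  rcases le_or_gt p.2 0 with h0 | h0
  · rw [eMinus_of_nonpos (p := (p.1 - w, p.2)) h0, norm_zero]; positivity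
  have h1 : ‖w‖ / 2 ≤ ‖p.1 - w‖ := by
    have := norm_sub_norm_le w p.1
    rw [norm_sub_rev] at this
    linarith
  rw [← div_eq_mul_inv, le_div_iff₀ (by positivity)]
  have h2 := hb (p.1 - w) p.2 h0.le
  calc _ = ‖eMinus ε (p.1 - w, p.2)‖ * (‖w‖ / 2) ^ (n + 2) * 2 ^ (n + 2) := by
        rw [div_pow]; field_simp
    _ ≤ ‖eMinus ε (p.1 - w, p.2)‖ * ‖p.1 - w‖ ^ (n + 2 * 1) * 2 ^ (n + 2) := by gcongr
    _ ≤ C * p.2 ^ 1 * 2 ^ (n + 2) := by gcongr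
    _ ≤ _ := by rw [pow_one]; gcongr

end Decay

/-! ### Reflections -/

section Reflection

variable {N : ℕ}

lemma reflLast_apply (σ : ℤˣ) (x : E (N + 1)) (i : Fin (N + 1)) :
    reflLast σ x i = if i = Fin.last N then ((σ : ℤ) : ℝ) * x i else x i := rfl

lemma reflLast_one (x : E (N + 1)) : reflLast 1 x = x := by
  ext i; simp [reflLast_apply]

lemma reflLast_reflLast (σ τ : ℤˣ) (x : E (N + 1)) :
    reflLast σ (reflLast τ x) = reflLast (σ * τ) x := by
  ext i
  simp only [reflLast_apply]
  split_ifs <;> push_cast <;> ring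

lemma reflLast_self (σ : ℤˣ) (x : E (N + 1)) : reflLast σ (reflLast σ x) = x := by
  rw [reflLast_reflLast, Int.units_mul_self, reflLast_one]

/-- The reflection as a linear isometry. -/
def reflIso (σ : ℤˣ) : E (N + 1) ≃ₗᵢ[ℝ] E (N + 1) where
  toFun := reflLast σ
  invFun := reflLast σ
  left_inv := reflLast_self σ
  right_inv := reflLast_self σ
  map_add' x y := by
    ext i; simp only [reflLast_apply, PiLp.add_apply]; split_ifs <;> ring
  map_smul' c x := by
    ext i
    simp only [reflLast_apply, PiLp.smul_apply, smul_eq_mul, RingHom.id_apply]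
    split_ifs <;> ring
  norm_map' x := by
    rw [EuclideanSpace.norm_eq, EuclideanSpace.norm_eq]
    congr 1
    refine Finset.sum_congr rfl fun i _ => ?_
    have : ‖((σ : ℤ) : ℝ)‖ = 1 := by
      rcases Int.units_eq_one_or σ with rfl | rfl <;> simp
    change ‖reflLast σ x i‖ ^ 2 = ‖x i‖ ^ 2
    rw [reflLast_apply]
    split_ifs
    · rw [norm_mul, this, one_mul]
    · rfl

lemma reflLast_add (σ : ℤˣ) (x y : E (N + 1)) :
    reflLast σ (x + y) = reflLast σ x + reflLast σ y := map_add (reflIso σ) x y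

lemma reflLast_sub (σ : ℤˣ) (x y : E (N + 1)) :
    reflLast σ (x - y) = reflLast σ x - reflLast σ y := map_sub (reflIso σ) x y

lemma norm_reflLast (σ : ℤˣ) (x : E (N + 1)) : ‖reflLast σ x‖ = ‖x‖ := (reflIso σ).norm_map x

end Reflection

/-! ### Lattices compatible with the reflection -/

section Lattice

variable {N d : ℕ} {lat : (Fin d → ℤ) → E (N + 1)} {s χ : (Fin d → ℤ) → ℤˣ} {ε : ℝ}

/-- A lattice that is mapped to itself by the reflection of the last coordinate, with a parity
character and a sign rule that are compatible with this reflection. The sign rule is not assumed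
to be multiplicative. -/
structure IsTwistedLattice (lat : (Fin d → ℤ) → E (N + 1)) (s χ : (Fin d → ℤ) → ℤˣ) : Prop where
  exists_basis : ∃ w : Fin d → E (N + 1), LinearIndependent ℝ w ∧ ∀ m, lat m = ∑ i, m i • w i
  parity_add : ∀ m m', χ (m + m') = χ m * χ m'
  sign_neg : ∀ m, s (-m) = s m
  exists_refl : ∀ m, ∃ m', reflLast (-1) (lat m) = lat m' ∧ s m' = s m ∧ χ m' = χ m

namespace IsTwistedLattice

variable (h : IsTwistedLattice lat s χ)
include h

lemma lat_add (m m' : Fin d → ℤ) : lat (m + m') = lat m + lat m' := by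
  obtain ⟨w, -, hl⟩ := h.exists_basis
  simp [hl, add_smul, Finset.sum_add_distrib]

lemma lat_zero : lat 0 = 0 := by
  obtain ⟨w, -, hl⟩ := h.exists_basis
  simp [hl]

lemma lat_neg (m : Fin d → ℤ) : lat (-m) = -lat m :=
  eq_neg_of_add_eq_zero_left (by rw [← h.lat_add, neg_add_cancel, h.lat_zero])

lemma lat_sub (m m' : Fin d → ℤ) : lat (m - m') = lat m - lat m' := by
  rw [sub_eq_add_neg, h.lat_add, h.lat_neg, sub_eq_add_neg]

lemma parity_zero : χ 0 = 1 := by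
  have := h.parity_add 0 0
  rw [add_zero, Int.units_mul_self] at this
  exact this

lemma parity_neg (m : Fin d → ℤ) : χ (-m) = χ m := by
  have h1 := h.parity_add (-m) m
  rw [neg_add_cancel, h.parity_zero] at h1
  have h2 := congrArg (· * χ m) h1
  simpa [mul_assoc, Int.units_mul_self] using h2.symm

/-- The lattice is bounded below by a multiple of the coefficients. -/
lemma exists_norm_le : ∃ K : ℝ, 0 < K ∧ ∀ m, ‖fun i => (m i : ℝ)‖ ≤ K * ‖lat m‖ := by
  obtain ⟨w, hw, hl⟩ := h.exists_basis
  obtain ⟨K, hK, hKl⟩ := LinearMap.exists_antilipschitzWith (Fintype.linearCombination ℝ w)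
    (LinearMap.ker_eq_bot.2 hw.fintypeLinearCombination_injective)
  refine ⟨K, hK, fun m => ?_⟩
  have h1 := hKl.le_mul_dist (fun i => (m i : ℝ)) 0
  rw [map_zero, dist_zero_right, dist_zero_right] at h1
  rw [Fintype.linearCombination_apply] at h1
  simpa [hl, Int.cast_smul_eq_zsmul] using h1

lemma lat_injective : Function.Injective lat := by
  obtain ⟨K, hK, hb⟩ := h.exists_norm_le
  intro m m' hmm
  have h1 := hb (m - m')
  rw [h.lat_sub, hmm, sub_self, norm_zero, mul_zero] at h1
  have h2 := norm_le_zero_iff.1 h1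
  funext i
  have h3 := congrFun h2 i
  simp only [Pi.sub_apply, Pi.zero_apply, Int.cast_eq_zero] at h3
  linarith

lemma card_le : d ≤ N + 1 := by
  obtain ⟨w, hw, -⟩ := h.exists_basis
  simpa using hw.fintype_card_le_finrank

/-- The exponent `n + 2`, with `n = N + 1`, exceeds the rank `d ≤ n` of the lattice. -/
lemma summable_inv_norm_pow : Summable fun m => (‖lat m‖ ^ (N + 1 + 2))⁻¹ := by
  obtain ⟨K, hK, hb⟩ := h.exists_norm_le
  set L := Submodule.span ℤ (Set.range (Pi.basisFun ℝ (Fin d)))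
  have hli : LinearIndependent ℤ (Pi.basisFun ℝ (Fin d)) :=
    (Pi.basisFun ℝ (Fin d)).linearIndependent.restrict_scalars
      (fun a b hab => by simpa using hab)
  set B := Module.Basis.span hli
  have hfr : Module.finrank ℤ L = d := by
    rw [Module.finrank_eq_card_basis B, Fintype.card_fin]
  have h1 := ZLattice.summable_norm_pow_inv L (N + 1 + 2)
    (by rw [hfr]; have := h.card_le; omega)
  have h2 := (B.equivFun.symm.toEquiv.summable_iff).2 h1
  have h3 : ∀ m : Fin d → ℤ, ((B.equivFun.symm m : L) : Fin d → ℝ) = fun i => (m i : ℝ) := by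
    intro m
    rw [Module.Basis.equivFun_symm_apply]
    funext j
    simp [B, Module.Basis.span_apply, Finset.sum_apply, Pi.single_apply]
  refine (h2.mul_left (K ^ (N + 1 + 2))).of_nonneg_of_le (fun m => by positivity) fun m => ?_
  have h4 : ‖(B.equivFun.symm.toEquiv m : L)‖ = ‖fun i => (m i : ℝ)‖ := by
    rw [← h3 m]; rfl
  simp only [Function.comp_apply, h4]
  have h5 := hb m
  rcases (norm_nonneg (fun i => (m i : ℝ))).eq_or_lt with h0 | h0
  · have hm : m = 0 := by
      have := norm_eq_zero.1 h0.symm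
      funext i; simpa using congrFun this i
    rw [hm, h.lat_zero, norm_zero]
    simp only [ne_eq, Nat.add_eq_zero_iff, OfNat.ofNat_ne_zero, and_false, not_false_eq_true,
      zero_pow, inv_zero]
    positivity
  · have hlp : 0 < ‖lat m‖ := pos_of_mul_pos_right (h0.trans_le h5) hK.le
    rw [← mul_pow, ← inv_pow]
    refine pow_le_pow_left₀ (by positivity) ?_ _
    rw [← div_eq_mul_inv, inv_eq_one_div, div_le_div_iff₀ hlp h0, one_mul]
    exact h5

lemma eventually_le_norm (r : ℝ) : ∀ᶠ m in Filter.cofinite, r ≤ ‖lat m‖ := by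
  have h1 := h.summable_inv_norm_pow.tendsto_cofinite_zero
  have hr : 0 < |r| + 1 := by positivity
  have h2 := h1.eventually (gt_mem_nhds (show (0 : ℝ) < ((|r| + 1) ^ (N + 1 + 2))⁻¹ by positivity))
  have h3 : ∀ᶠ m in Filter.cofinite, m ≠ (0 : Fin d → ℤ) := by
    simp
  filter_upwards [h2, h3] with m hm hm0
  have hpos : 0 < ‖lat m‖ := by
    rw [norm_pos_iff, ← h.lat_zero]; exact fun h4 => hm0 (h.lat_injective h4)
  rw [inv_lt_inv₀ (by positivity) (by positivity)] at hm
  have h5 := lt_of_pow_lt_pow_left₀ _ hpos.le hm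
  linarith [le_abs_self r]

lemma summable_inv_one_add_norm_pow : Summable fun m => ((1 + ‖lat m‖) ^ (N + 1 + 2))⁻¹ := by
  refine Summable.of_norm_bounded_eventually h.summable_inv_norm_pow ?_
  filter_upwards [h.eventually_le_norm 1] with m hm
  rw [Real.norm_of_nonneg (by positivity)]
  have : 0 < ‖lat m‖ := by linarith
  gcongr
  linarith

lemma exists_reflLast (σ : ℤˣ) (m : Fin d → ℤ) :
    ∃ m', reflLast σ (lat m) = lat m' ∧ s m' = s m ∧ χ m' = χ m := by
  rcases Int.units_eq_one_or σ with rfl | rfl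
  · exact ⟨m, reflLast_one _, rfl, rfl⟩
  · exact h.exists_refl m

/-- The permutation of the lattice induced by a reflection. -/
lemma exists_perm_refl (σ : ℤˣ) : ∃ ρ : Equiv.Perm (Fin d → ℤ), ∀ m,
    reflLast σ (lat m) = lat (ρ m) ∧ χ (ρ m) = χ m := by
  choose ρ hρ _ hχ using h.exists_reflLast σ
  have hinv : Function.Involutive ρ := fun m => h.lat_injective <| by
    rw [← hρ, ← hρ, reflLast_self]
  exact ⟨hinv.toPerm, fun m => ⟨hρ m, hχ m⟩⟩

/-- The involution `τ` of the index set given by `lat (τ m) = -R lat m`, where `R` is the reflection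
with sign `s m`. It turns the twisted series into a plain periodization, because
`R (R x + lat m) = x - lat (τ m)`, and it corresponds to inversion of the identifications. -/
lemma exists_perm_flip : ∃ τ : Equiv.Perm (Fin d → ℤ), Function.Involutive τ ∧ ∀ m,
    reflLast (s m) (lat m) = -lat (τ m) ∧ s (τ m) = s m ∧ χ (τ m) = χ m := by
  choose ρ hρ hs hχ using fun m => h.exists_reflLast (s m) m
  have hinv : Function.Involutive fun m => -ρ m := fun m => h.lat_injective <| by
    change lat (-ρ (-ρ m)) = lat m
    rw [h.lat_neg, ← hρ, h.sign_neg, hs, h.lat_neg, ← hρ]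
    have : reflLast (s m) (-reflLast (s m) (lat m)) = -reflLast (s m) (reflLast (s m) (lat m)) :=
      map_neg (reflIso (s m)) _
    rw [this, reflLast_self, neg_neg]
  refine ⟨hinv.toPerm, hinv, fun m => ⟨?_, ?_, ?_⟩⟩
  · change _ = -lat (-ρ m)
    rw [h.lat_neg, neg_neg, hρ]
  · change s (-ρ m) = s m
    rw [h.sign_neg, hs]
  · change χ (-ρ m) = χ m
    rw [h.parity_neg, hχ]

end IsTwistedLattice

/-- The term `χ(m) e₋^ε(x - lat m, t)` of the plain periodization. -/
def periodTerm (lat : (Fin d → ℤ) → E (N + 1)) (χ : (Fin d → ℤ) → ℤˣ) (ε : ℝ) (m : Fin d → ℤ)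
    (p : SpaceTime (N + 1)) : ℂ :=
  (((χ m : ℤˣ) : ℤ) : ℂ) * eMinus ε (p.1 - lat m, p.2)

lemma norm_units_cast (σ : ℤˣ) : ‖(((σ : ℤˣ) : ℤ) : ℂ)‖ = 1 := by
  rcases Int.units_eq_one_or σ with rfl | rfl <;> simp

lemma norm_periodTerm (m : Fin d → ℤ) (p : SpaceTime (N + 1)) :
    ‖periodTerm lat χ ε m p‖ = ‖eMinus ε (p.1 - lat m, p.2)‖ := by
  rw [periodTerm, norm_mul, norm_units_cast, one_mul]

/-- The reflections in the terms of the twisted series only permute these terms, because the kernel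
is radial in space. -/
lemma IsTwistedLattice.exists_perm_seriesTerm (h : IsTwistedLattice lat s χ) (ε : ℝ) :
    ∃ τ : Equiv.Perm (Fin d → ℤ), ∀ m, seriesTerm lat s χ ε m = periodTerm lat χ ε (τ m) := by
  obtain ⟨τ, -, hτ⟩ := h.exists_perm_flip
  refine ⟨τ, fun m => funext fun p => ?_⟩
  rw [seriesTerm, periodTerm, (hτ m).2.2]
  congr 1
  refine eMinus_congr_norm ?_ p.2
  have h1 : reflLast (s m) (reflLast (s m) p.1 + lat m) = p.1 - lat (τ m) := by
    rw [reflLast_add, reflLast_self, (hτ m).1, sub_eq_add_neg]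
  rw [← h1, norm_reflLast]

lemma IsTwistedLattice.twistedSeries_eq (h : IsTwistedLattice lat s χ) (ε : ℝ) :
    twistedSeries lat s χ ε = fun p => ∑' m, periodTerm lat χ ε m p := by
  obtain ⟨τ, hτ⟩ := h.exists_perm_seriesTerm ε
  funext p
  rw [twistedSeries]
  simp_rw [hτ]
  exact τ.tsum_eq fun m => periodTerm lat χ ε m p

lemma contDiffOn_periodTerm (m : Fin d → ℤ) :
    ContDiffOn ℝ ∞ (periodTerm lat χ ε m) {p | 0 < p.2} := by
  refine contDiffOn_const.mul ?_
  exact (contDiffOn_eMinus ε (N + 1)).comp (g := eMinus ε)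
    (f := fun p : SpaceTime (N + 1) => (p.1 - lat m, p.2))
    (ContDiff.contDiffOn (by fun_prop)) fun p hp => hp

lemma schrodingerOp_comp_sub {n : ℕ} (f : SpaceTime n → ℂ) (w : E n) (p : SpaceTime n) :
    schrodingerOp ε (fun p => f (p.1 - w, p.2)) p = schrodingerOp ε f (p.1 - w, p.2) := by
  simp only [schrodingerOp]
  congr 1
  simp only [InnerProductSpace.laplacian_eq_iteratedFDeriv_stdOrthonormalBasis]
  refine Finset.sum_congr rfl fun i _ => ?_
  rw [iteratedFDeriv_comp_sub 2 w (f := fun y => f (y, p.2))]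

lemma schrodingerOp_const_mul {n : ℕ} {f : SpaceTime n → ℂ} {p : SpaceTime n}
    (hf : ContDiffAt ℝ 2 f p) (c : ℂ) :
    schrodingerOp ε (fun p => c * f p) p = c * schrodingerOp ε f p := by
  have h1 : ContDiffAt ℝ 2 (fun y : E n => f (y, p.2)) p.1 :=
    ContDiffAt.comp p.1 (f := fun y : E n => (y, p.2)) (g := f) hf (by fun_prop)
  have h2 : DifferentiableAt ℝ (fun τ : ℝ => f (p.1, τ)) p.2 :=
    (ContDiffAt.comp p.2 (f := fun τ : ℝ => (p.1, τ)) (g := f) hf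
      (by fun_prop)).differentiableAt (by norm_num)
  have h3 := InnerProductSpace.laplacian_smul c h1
  simp only [schrodingerOp]
  rw [deriv_const_mul c h2]
  change Laplacian.laplacian (c • fun y : E n => f (y, p.2)) p.1 - _ = _
  rw [h3, smul_eq_mul]
  ring

lemma schrodingerOp_periodTerm (m : Fin d → ℤ) {p : SpaceTime (N + 1)} (hp : 0 < p.2) :
    schrodingerOp ε (periodTerm lat χ ε m) p = 0 := by
  have h1 : ContDiffAt ℝ 2 (fun p : SpaceTime (N + 1) => eMinus ε (p.1 - lat m, p.2)) p := by
    refine ContDiffAt.comp p (g := eMinus ε)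
      (f := fun p : SpaceTime (N + 1) => (p.1 - lat m, p.2)) ?_ (by fun_prop)
    exact (contDiffAt_eMinus (p := (p.1 - lat m, p.2)) hp).of_le (by norm_cast)
  have h2 := schrodingerOp_const_mul (ε := ε) h1 (((χ m : ℤˣ) : ℤ) : ℂ)
  rw [schrodingerOp_comp_sub, schrodingerOp_eMinus (p := (p.1 - lat m, p.2)) hp, mul_zero] at h2
  exact h2

end Lattice

/-! ### The periodization -/

/-- A countable series with summable `L¹` norms has an integrable sum. -/
lemma integrable_tsum_of_summable_integral_norm {α ι : Type*} [Countable ι] {mα : MeasurableSpace α}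
    {μ : Measure α} {F : ι → α → ℂ} (hF : ∀ i, Integrable (F i) μ)
    (hs : Summable fun i => ∫ a, ‖F i a‖ ∂μ) : Integrable (fun a => ∑' i, F i a) μ := by
  have hlt : ∑' i, ∫⁻ a, ‖F i a‖ₑ ∂μ ≠ ⊤ := by
    have h1 : ∀ i, ∫⁻ a, ‖F i a‖ₑ ∂μ = ENNReal.ofReal (∫ a, ‖F i a‖ ∂μ) := fun i => by
      rw [ofReal_integral_norm_eq_lintegral_enorm (hF i)]
    simp_rw [h1]
    exact hs.tsum_ofReal_ne_top
  have hae : ∀ᵐ a ∂μ, Summable fun i => ‖F i a‖ := by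
    refine summable_norm_of_tsum_eLpNorm_ne_top le_rfl (fun i => (hF i).1) ?_
    simpa [eLpNorm_one_eq_lintegral_enorm] using hlt
  refine ⟨?_, ?_⟩
  · refine aestronglyMeasurable_of_tendsto_ae (u := Filter.atTop)
      (f := fun (S : Finset ι) a => ∑ i ∈ S, F i a)
      (fun S => Finset.aestronglyMeasurable_fun_sum S fun i _ => (hF i).1) ?_
    filter_upwards [hae] with a ha using ha.of_norm.hasSum
  · refine lt_of_le_of_lt (lintegral_mono_ae (g := fun a => ∑' i, ‖F i a‖ₑ) ?_) ?_
    · filter_upwards [hae] with a ha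
      exact enorm_tsum_le_tsum_enorm
    · rw [lintegral_tsum fun i => (hF i).1.enorm]
      exact hlt.lt_top

section Periodization

instance volume_spaceTime_isAddHaarMeasure (n : ℕ) :
    (volume : Measure (SpaceTime n)).IsAddHaarMeasure :=
  inferInstanceAs ((volume : Measure (E n)).prod (volume : Measure ℝ)).IsAddHaarMeasure

variable {N d : ℕ} {lat : (Fin d → ℤ) → E (N + 1)} {s χ : (Fin d → ℤ) → ℤˣ} {ε : ℝ}

namespace IsTwistedLattice

/-- Normal convergence down to time zero, after removal of finitely many terms. -/
lemma exists_summable_bound (h : IsTwistedLattice lat s χ) (hε : 0 < ε) {R T : ℝ} (hR : 0 < R)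
    (hT : 0 ≤ T) : ∃ u : (Fin d → ℤ) → ℝ, Summable u ∧ ∀ᶠ m in Filter.cofinite,
      ∀ p : SpaceTime (N + 1), ‖p.1‖ ≤ R → p.2 ≤ T → ‖periodTerm lat χ ε m p‖ ≤ u m := by
  obtain ⟨C, -, hC⟩ := exists_norm_eMinus_sub_le (n := N + 1) hε hR hT
  refine ⟨fun m => C * (‖lat m‖ ^ (N + 1 + 2))⁻¹, h.summable_inv_norm_pow.mul_left C, ?_⟩
  filter_upwards [h.eventually_le_norm (2 * R)] with m hm p hp hpT
  rw [norm_periodTerm]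
  exact hC (lat m) hm p hp hpT

lemma normal_convergence_periodTerm (h : IsTwistedLattice lat s χ) (hε : 0 < ε)
    {K : Set (SpaceTime (N + 1))} (hK : IsCompact K) (hKlat : ∀ m, ((lat m, 0) : SpaceTime (N + 1)) ∉ K) :
    ∃ u : (Fin d → ℤ) → ℝ, Summable u ∧ ∀ m, ∀ p ∈ K, ‖periodTerm lat χ ε m p‖ ≤ u m := by
  obtain ⟨B, hB0, hB⟩ := hK.isBounded.exists_pos_norm_le
  obtain ⟨u, hu, hub⟩ := h.exists_summable_bound (χ := χ) hε hB0 hB0.le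
  have hcont : ∀ m, ContinuousOn (periodTerm lat χ ε m) K := fun m p hp => by
    have hne : ((p.1 - lat m, p.2) : SpaceTime (N + 1)) ≠ 0 := fun h0 => by
      rw [Prod.mk_eq_zero, sub_eq_zero] at h0
      exact hKlat m (by rw [← h0.1, ← h0.2]; exact hp)
    refine ContinuousAt.continuousWithinAt (continuousAt_const.mul ?_)
    exact ContinuousAt.comp (g := eMinus ε) (f := fun p : SpaceTime (N + 1) => (p.1 - lat m, p.2))
      (continuousAt_eMinus hε hne) (by fun_prop)
  choose C hC using fun m => hK.exists_bound_of_continuousOn (hcont m)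
  classical
  have hev : ∀ᶠ m in Filter.cofinite, ∀ p ∈ K, ‖periodTerm lat χ ε m p‖ ≤ u m :=
    hub.mono fun m hm p hp => hm p ((norm_fst_le p).trans (hB p hp))
      ((le_abs_self _).trans ((norm_snd_le p).trans (hB p hp)))
  refine ⟨fun m => if ∀ p ∈ K, ‖periodTerm lat χ ε m p‖ ≤ u m then u m else C m, ?_,
    fun m p hp => ?_⟩
  · refine hu.congr_cofinite (hev.mono fun m hm => ?_)
    dsimp only
    rw [if_pos hm]
  · dsimp only
    split_ifs with hm
    · exact hm p hp
    · exact hC m p hp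

lemma exists_iteratedFDeriv_bound (h : IsTwistedLattice lat s χ) (hε : 0 < ε) {R a b : ℝ}
    (hR : 0 ≤ R) (ha : 0 < a) (k : ℕ) : ∃ u : (Fin d → ℤ) → ℝ, Summable u ∧
      ∀ m, ∀ p ∈ timeBox (N + 1) R a b, ‖iteratedFDeriv ℝ k (periodTerm lat χ ε m) p‖ ≤ u m := by
  obtain ⟨C, hC⟩ := exists_norm_iteratedFDeriv_eMinus_sub_le (n := N + 1) (b := b) hε hR ha k
  refine ⟨_, h.summable_inv_one_add_norm_pow.mul_left C, fun m p hp => ?_⟩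
  have hp0 : 0 < p.2 := timeBox_subset ha hp
  have h1 : ContDiffAt ℝ k (fun p : SpaceTime (N + 1) => eMinus ε (p.1 - lat m, p.2)) p := by
    refine ContDiffAt.comp p (g := eMinus ε)
      (f := fun p : SpaceTime (N + 1) => (p.1 - lat m, p.2)) ?_ (by fun_prop)
    exact (contDiffAt_eMinus (p := (p.1 - lat m, p.2)) hp0).of_le (by exact_mod_cast le_top)
  have h2 : periodTerm lat χ ε m = (((χ m : ℤˣ) : ℤ) : ℂ) •
      fun p : SpaceTime (N + 1) => eMinus ε (p.1 - lat m, p.2) := rfl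
  rw [h2, iteratedFDeriv_const_smul_apply h1, norm_smul, norm_units_cast, one_mul]
  exact hC (lat m) p hp

/-- An open convex neighbourhood at positive times on which the series may be differentiated. -/
lemma exists_nhds_bound (h : IsTwistedLattice lat s χ) (hε : 0 < ε) {p : SpaceTime (N + 1)}
    (hp : 0 < p.2) : ∃ U : Set (SpaceTime (N + 1)), IsOpen U ∧ IsPreconnected U ∧ p ∈ U ∧
      U ⊆ {p | 0 < p.2} ∧ ∀ k : ℕ, ∃ u : (Fin d → ℤ) → ℝ, Summable u ∧
        ∀ m, ∀ q ∈ U, ‖iteratedFDeriv ℝ k (periodTerm lat χ ε m) q‖ ≤ u m := by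
  have ha : 0 < p.2 / 2 := by positivity
  have hsub : Metric.ball (0 : E (N + 1)) (‖p.1‖ + 1) ×ˢ Set.Ioo (p.2 / 2) (2 * p.2) ⊆
      timeBox (N + 1) (‖p.1‖ + 1) (p.2 / 2) (2 * p.2) :=
    Set.prod_mono Metric.ball_subset_closedBall Set.Ioo_subset_Icc_self
  refine ⟨_, Metric.isOpen_ball.prod isOpen_Ioo,
    ((convex_ball _ _).prod (convex_Ioo _ _)).isPreconnected, ⟨by simp, by linarith, by linarith⟩,
    hsub.trans (timeBox_subset ha), fun k => ?_⟩
  obtain ⟨u, hu, hub⟩ := h.exists_iteratedFDeriv_bound (b := 2 * p.2) hε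
    (R := ‖p.1‖ + 1) (by positivity) ha k
  exact ⟨u, hu, fun m q hq => hub m q (hsub hq)⟩

lemma contDiffOn_tsum (h : IsTwistedLattice lat s χ) (hε : 0 < ε) :
    ContDiffOn ℝ ∞ (fun p => ∑' m, periodTerm lat χ ε m p) {p | 0 < p.2} := by
  intro p hp
  obtain ⟨U, hU, hc, hpU, hUs, hb⟩ := h.exists_nhds_bound hε hp
  exact ((contDiffOn_tsum_of_bounds hU hc (fun m => (contDiffOn_periodTerm m).mono hUs)
    hb).contDiffAt (hU.mem_nhds hpU)).contDiffWithinAt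

lemma schrodingerOp_tsum (h : IsTwistedLattice lat s χ) (hε : 0 < ε) {p : SpaceTime (N + 1)}
    (hp : 0 < p.2) : schrodingerOp ε (fun p => ∑' m, periodTerm lat χ ε m p) p = 0 := by
  obtain ⟨U, hU, hc, hpU, hUs, hb⟩ := h.exists_nhds_bound hε hp
  have hsm : ∀ m, ContDiffOn ℝ ∞ (periodTerm lat χ ε m) U :=
    fun m => (contDiffOn_periodTerm m).mono hUs
  have hs1 := hasSum_fderiv_of_bounds hU hc hsm hb hpU
  have hs2 := hasSum_fderiv_fderiv_of_bounds hU hc hsm hb hpU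
  have hcd : ContDiffAt ℝ 2 (fun p => ∑' m, periodTerm lat χ ε m p) p :=
    ((h.contDiffOn_tsum hε).contDiffAt (isOpen_pos_time.mem_nhds hp)).of_le (by norm_cast)
  rw [schrodingerOp_eq hcd]
  have e1 := (ContinuousLinearMap.apply ℝ ℂ ((0, 1) : SpaceTime (N + 1))).hasSum hs1
  have e2 : HasSum (fun m => spaceLap (fderiv ℝ (fderiv ℝ (periodTerm lat χ ε m)) p))
      (spaceLap (fderiv ℝ (fderiv ℝ (fun p => ∑' m, periodTerm lat χ ε m p)) p)) := by
    refine hasSum_sum fun i _ => ?_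
    set v : SpaceTime (N + 1) := (EuclideanSpace.basisFun (Fin (N + 1)) ℝ i, 0)
    exact (ContinuousLinearMap.apply ℝ ℂ v).hasSum
      ((ContinuousLinearMap.apply ℝ (SpaceTime (N + 1) →L[ℝ] ℂ) v).hasSum hs2)
  simp only [ContinuousLinearMap.apply_apply] at e1
  have e3 := e2.sub (e1.mul_left (kReg ε))
  have e4 : ∀ m, spaceLap (fderiv ℝ (fderiv ℝ (periodTerm lat χ ε m)) p) -
      kReg ε * fderiv ℝ (periodTerm lat χ ε m) p (0, 1) = 0 := fun m => by
    rw [← schrodingerOp_eq (((contDiffOn_periodTerm m).contDiffAt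
      (isOpen_pos_time.mem_nhds hp)).of_le (by norm_cast)), schrodingerOp_periodTerm m hp]
  simp_rw [e4] at e3
  exact e3.unique hasSum_zero

lemma tsum_reflLast (h : IsTwistedLattice lat s χ) (σ : ℤˣ) (z : E (N + 1)) (t : ℝ) :
    ∑' m, periodTerm lat χ ε m (reflLast σ z, t) = ∑' m, periodTerm lat χ ε m (z, t) := by
  obtain ⟨ρ, hρ⟩ := h.exists_perm_refl σ
  rw [← ρ.tsum_eq]
  refine tsum_congr fun m => ?_
  rw [periodTerm, periodTerm, (hρ m).2, ← (hρ m).1, ← reflLast_sub]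
  congr 1
  exact eMinus_congr_norm (norm_reflLast _ _) t

lemma tsum_add_lat (h : IsTwistedLattice lat s χ) (m : Fin d → ℤ) (z : E (N + 1)) (t : ℝ) :
    ∑' m', periodTerm lat χ ε m' (z + lat m, t) =
      (((χ m : ℤˣ) : ℤ) : ℂ) * ∑' m', periodTerm lat χ ε m' (z, t) := by
  rw [← (Equiv.addRight m).tsum_eq, ← tsum_mul_left]
  refine tsum_congr fun m' => ?_
  simp only [periodTerm, Equiv.coe_addRight]
  rw [h.parity_add, h.lat_add, add_sub_add_right_eq_sub]
  push_cast
  ring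

lemma twistedSeries_equivariant (h : IsTwistedLattice lat s χ) (ε : ℝ) (m : Fin d → ℤ)
    (z : E (N + 1)) (t : ℝ) :
    twistedSeries lat s χ ε (reflLast (s m) z, t) =
      (((χ m : ℤˣ) : ℤ) : ℂ) * twistedSeries lat s χ ε (z + lat m, t) := by
  rw [h.twistedSeries_eq]
  simp only
  rw [h.tsum_reflLast, h.tsum_add_lat, ← mul_assoc]
  have : (((χ m : ℤˣ) : ℤ) : ℂ) * (((χ m : ℤˣ) : ℤ) : ℂ) = 1 := by
    rcases Int.units_eq_one_or (χ m) with h1 | h1 <;> simp [h1]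
  rw [this, one_mul]

/-- Equivariance is what is needed for the section to be well defined on classes. -/
lemma descends (h : IsTwistedLattice lat s χ) (ε : ℝ) :
    ∃! σ : Base lat s × Set.Ioi (0 : ℝ) → Bundle lat s χ,
      (∀ q, bundleProj lat s χ (σ q) = q.1) ∧
      ∀ (x : E (N + 1)) (t : Set.Ioi (0 : ℝ)), σ (Quot.mk _ x, t) =
        Quot.mk _ (x, twistedSeries lat s χ ε (x, t) • (1 : CliffordC (N + 1))) := by
  refine ⟨fun q => Quot.lift (fun x => (Quot.mk _
    (x, twistedSeries lat s χ ε (x, q.2) • (1 : CliffordC (N + 1))) : Bundle lat s χ)) ?_ q.1,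
    ⟨?_, fun x t => rfl⟩, ?_⟩
  · rintro x y ⟨m, z, rfl, rfl⟩
    refine Quot.sound ⟨m, z, rfl, rfl, ?_⟩
    change _ = (((χ m : ℤˣ) : ℤ) : ℂ) • (_ • (1 : CliffordC (N + 1)))
    rw [h.twistedSeries_equivariant, smul_smul]
  · rintro ⟨q, t⟩
    induction q using Quot.ind
    rfl
  · rintro σ ⟨-, hσ⟩
    funext ⟨q, t⟩
    induction q using Quot.ind
    exact hσ _ t

lemma integrableOn_periodTerm (hε : 0 < ε) (m : Fin d → ℤ) (T : ℝ) :
    IntegrableOn (periodTerm lat χ ε m) (Set.univ ×ˢ Set.Iic T) := by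
  have h1 := (integrableOn_eMinus hε (N + 1) T)
  rw [← integrable_indicator_iff (MeasurableSet.univ.prod measurableSet_Iic)] at h1 ⊢
  have h2 := (h1.comp_sub_right ((lat m, 0) : SpaceTime (N + 1))).const_mul (((χ m : ℤˣ) : ℤ) : ℂ)
  refine h2.congr (Filter.Eventually.of_forall fun p => ?_)
  have hsub : p - (lat m, 0) = (p.1 - lat m, p.2) := by ext <;> simp
  simp only [hsub]
  by_cases hp : p.2 ≤ T <;> simp [Set.indicator, periodTerm, hp]

lemma summable_integral_norm (h : IsTwistedLattice lat s χ) (hε : 0 < ε) {R : ℝ} (hR : 0 < R) :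
    Summable fun m => ∫ p in Metric.closedBall (0 : SpaceTime (N + 1)) R,
      ‖periodTerm lat χ ε m p‖ := by
  obtain ⟨u, hu, hub⟩ := h.exists_summable_bound (χ := χ) hε hR hR.le
  refine Summable.of_norm_bounded_eventually
    (hu.mul_right (volume.real (Metric.closedBall (0 : SpaceTime (N + 1)) R))) ?_
  filter_upwards [hub] with m hm
  refine norm_setIntegral_le_of_norm_le_const measure_closedBall_lt_top fun p hp => ?_
  rw [norm_norm]
  rw [mem_closedBall_zero_iff] at hp
  exact hm p ((norm_fst_le p).trans hp) ((le_abs_self _).trans ((norm_snd_le p).trans hp))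

lemma integrableOn_closedBall_periodTerm (hε : 0 < ε) (m : Fin d → ℤ) (R : ℝ) :
    IntegrableOn (periodTerm lat χ ε m) (Metric.closedBall (0 : SpaceTime (N + 1)) R) := by
  refine (integrableOn_periodTerm hε m R).mono_set fun p hp => ⟨trivial, ?_⟩
  rw [mem_closedBall_zero_iff] at hp
  exact (le_abs_self _).trans ((norm_snd_le p).trans hp)

lemma locallyIntegrable_tsum (h : IsTwistedLattice lat s χ) (hε : 0 < ε) :
    LocallyIntegrable (fun p => ∑' m, periodTerm lat χ ε m p) volume := by
  rw [locallyIntegrable_iff]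
  intro K hK
  obtain ⟨B, hB0, hB⟩ := hK.isBounded.exists_pos_norm_le
  have h1 : IntegrableOn (fun p => ∑' m, periodTerm lat χ ε m p)
      (Metric.closedBall (0 : SpaceTime (N + 1)) B) :=
    integrable_tsum_of_summable_integral_norm
      (fun m => integrableOn_closedBall_periodTerm hε m B) (h.summable_integral_norm hε hB0)
  exact h1.mono_set fun p hp => mem_closedBall_zero_iff.2 (hB p hp)

end IsTwistedLattice

lemma schrodingerOpTranspose_comp_add {n : ℕ} (f : SpaceTime n → ℂ) (w : E n) (p : SpaceTime n) :
    schrodingerOpTranspose ε (fun p => f (p + (w, 0))) p =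
      schrodingerOpTranspose ε f (p + (w, 0)) := by
  simp only [schrodingerOpTranspose, add_zero, Prod.add_def]
  congr 1
  simp only [InnerProductSpace.laplacian_eq_iteratedFDeriv_stdOrthonormalBasis]
  refine Finset.sum_congr rfl fun i _ => ?_
  rw [iteratedFDeriv_comp_add_right 2 w (f := fun y => f (y, p.2))]

lemma HasBoundedJet.comp_add {n : ℕ} {f : SpaceTime n → ℂ} {C : ℝ} (hf : HasBoundedJet f C)
    (v : SpaceTime n) : HasBoundedJet (fun p => f (p + v)) C := by
  have h1 : fderiv ℝ (fun p => f (p + v)) = fun p => fderiv ℝ f (p + v) :=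
    funext fun p => fderiv_comp_add_right v
  refine ⟨hf.contDiff.comp (by fun_prop), fun p => hf.norm_le _, fun p => ?_, fun p => ?_⟩
  · rw [h1]; exact hf.norm_fderiv_le _
  · rw [h1, fderiv_comp_add_right]; exact hf.norm_fderiv_fderiv_le _

lemma hasBoundedJet_of_hasCompactSupport {n : ℕ} {f : SpaceTime n → ℂ} (hf : ContDiff ℝ ∞ f)
    (hc : HasCompactSupport f) : ∃ C, HasBoundedJet f C := by
  have hf2 : ContDiff ℝ 2 f := hf.of_le (by norm_cast)
  have hd1 : ContDiff ℝ 1 (fderiv ℝ f) := hf2.fderiv_right (by norm_num)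
  obtain ⟨C0, h0⟩ := hf2.continuous.bounded_above_of_compact_support hc
  obtain ⟨C1, h1⟩ := hd1.continuous.bounded_above_of_compact_support (hc.fderiv (𝕜 := ℝ))
  obtain ⟨C2, h2⟩ := (hd1.continuous_fderiv (by norm_num)).bounded_above_of_compact_support
    ((hc.fderiv (𝕜 := ℝ)).fderiv (𝕜 := ℝ))
  exact ⟨max C0 (max C1 C2), hf2, fun p => (h0 p).trans (le_max_left _ _),
    fun p => (h1 p).trans ((le_max_left _ _).trans (le_max_right _ _)),
    fun p => (h2 p).trans ((le_max_right _ _).trans (le_max_right _ _))⟩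

/-- Each term of the periodization is a multiple of a fundamental solution with pole at a lattice
point. -/
lemma integral_periodTerm_mul (hε : 0 < ε) (m : Fin d → ℤ) {f : SpaceTime (N + 1) → ℂ} {C T : ℝ}
    (hf : HasBoundedJet f C) (hT : ∀ x t, T < t → f (x, t) = 0) :
    Integrable (fun p => periodTerm lat χ ε m p * schrodingerOpTranspose ε f p) ∧
      ∫ p, periodTerm lat χ ε m p * schrodingerOpTranspose ε f p =
        (((χ m : ℤˣ) : ℤ) : ℂ) * f (lat m, 0) := by
  set v : SpaceTime (N + 1) := (lat m, 0) with hv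
  have hfv := hf.comp_add v
  have hTv : ∀ x t, T < t → f ((x, t) + v) = 0 := fun x t ht => by
    rw [hv, Prod.mk_add_mk, add_zero]; exact hT _ t ht
  have h1 := integrable_eMinus_mul hε hfv hTv
  have h2 := integral_eMinus_mul_schrodingerOpTranspose hε hfv hTv
  have hpt : ∀ p, periodTerm lat χ ε m p * schrodingerOpTranspose ε f p =
      (((χ m : ℤˣ) : ℤ) : ℂ) * (fun q => eMinus ε q *
        schrodingerOpTranspose ε (fun p => f (p + v)) q) (p - v) := fun p => by
    simp only
    rw [schrodingerOpTranspose_comp_add, sub_add_cancel, periodTerm, mul_assoc]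
    congr 3
    ext <;> simp [hv]
  simp_rw [hpt]
  refine ⟨(h1.comp_sub_right v).const_mul _, ?_⟩
  rw [integral_const_mul, integral_sub_right_eq_self (fun q => eMinus ε q *
        schrodingerOpTranspose ε (fun p => f (p + v)) q) v, h2]
  congr 2
  exact zero_add v

lemma IsTwistedLattice.lifted_equation (h : IsTwistedLattice lat s χ) (hε : 0 < ε)
    {φ : SpaceTime (N + 1) → ℂ} (hφ : ContDiff ℝ ∞ φ) (hc : HasCompactSupport φ) :
    HasSum (fun m => (((χ m : ℤˣ) : ℤ) : ℂ) * φ (lat m, 0))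
      (∫ p, (∑' m, periodTerm lat χ ε m p) * schrodingerOpTranspose ε φ p) := by
  obtain ⟨C, hC⟩ := hasBoundedJet_of_hasCompactSupport hφ hc
  obtain ⟨R, hR0, hR⟩ := hc.isCompact.isBounded.exists_pos_norm_le
  have hzero : ∀ p : SpaceTime (N + 1), R < ‖p‖ → φ p = 0 := fun p hp =>
    image_eq_zero_of_notMem_tsupport fun hmem => absurd (hR p hmem) (not_le.2 hp)
  have hT : ∀ x t, R < t → φ (x, t) = 0 := fun x t ht =>
    hzero _ (ht.trans_le ((le_abs_self t).trans (norm_snd_le (x, t))))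
  have hL0 : ∀ p ∉ Metric.closedBall (0 : SpaceTime (N + 1)) R,
      schrodingerOpTranspose ε φ p = 0 := fun p hp => by
    rw [mem_closedBall_zero_iff, not_le] at hp
    have hev : φ =ᶠ[nhds p] fun _ => 0 := by
      filter_upwards [(isOpen_lt continuous_const continuous_norm).mem_nhds hp] with q hq
      exact hzero q hq
    have hev1 : fderiv ℝ φ =ᶠ[nhds p] fun _ => 0 := by
      filter_upwards [hev.eventually_nhds] with q hq
      rw [(show φ =ᶠ[nhds q] fun _ => 0 from hq).fderiv_eq]; simp
    rw [schrodingerOpTranspose_eq hC.contDiff.contDiffAt, hev.fderiv_eq, hev1.fderiv_eq]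
    simp [spaceLap]
  have hint := fun m => integral_periodTerm_mul (lat := lat) (χ := χ) hε m hC hT
  have hsum : Summable fun m =>
      ∫ p, ‖periodTerm lat χ ε m p * schrodingerOpTranspose ε φ p‖ := by
    refine ((h.summable_integral_norm hε hR0).mul_right
      ((((N + 1 : ℕ) : ℝ) + ‖kReg ε‖) * C)).of_nonneg_of_le
      (fun m => integral_nonneg fun p => norm_nonneg _) fun m => ?_
    rw [← setIntegral_eq_integral_of_forall_compl_eq_zero
      (s := Metric.closedBall (0 : SpaceTime (N + 1)) R) fun p hp => by
        rw [hL0 p hp, mul_zero, norm_zero], ← integral_mul_const]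
    refine setIntegral_mono (hint m).1.norm.integrableOn
      ((IsTwistedLattice.integrableOn_closedBall_periodTerm hε m R).norm.mul_const _) fun p => ?_
    rw [norm_mul]
    gcongr
    exact hC.norm_schrodingerOpTranspose_le ε p
  have := hasSum_integral_of_summable_integral_norm (fun m => (hint m).1) hsum
  simp_rw [tsum_mul_right] at this
  simpa only [fun m => (hint m).2] using this

/-- The statements on the covering space, which also cover sign rules, such as `latticeSgn` in rank
at least two, that are not multiplicative. -/
theorem IsTwistedLattice.isPeriodizedFundamentalSolution (h : IsTwistedLattice lat s χ)
    (hε : 0 < ε) : IsPeriodizedFundamentalSolution lat s χ ε := by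
  obtain ⟨τ, hτ⟩ := h.exists_perm_seriesTerm ε
  refine ⟨fun K hK hKlat => ?_, fun m => ?_, ?_, h.twistedSeries_equivariant ε, h.descends ε, ?_, ?_⟩
  · obtain ⟨u, hu, hub⟩ := h.normal_convergence_periodTerm hε hK hKlat
    exact ⟨u ∘ τ, τ.summable_iff.2 hu, fun m p hp => by rw [hτ]; exact hub (τ m) p hp⟩
  · rw [hτ]
    exact ⟨contDiffOn_periodTerm _, fun p hp => schrodingerOp_periodTerm _ hp⟩
  · rw [h.twistedSeries_eq]
    exact ⟨h.contDiffOn_tsum hε, fun p hp => h.schrodingerOp_tsum hε hp⟩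
  · rw [h.twistedSeries_eq]
    exact h.locallyIntegrable_tsum hε
  · rw [h.twistedSeries_eq]
    exact fun φ hφ hc => h.lifted_equation hε hφ hc

end Periodization

/-! ### The action generated by the identifications -/

section Action

variable {N d : ℕ} {lat : (Fin d → ℤ) → E (N + 1)} {s χ : (Fin d → ℤ) → ℤˣ} {ε : ℝ}

/-- The isometry `x ↦ (x₁, …, x_{n-1}, s(m) xₙ) + lat m`, which identifies points of `ℝⁿ`. -/
def act (lat : (Fin d → ℤ) → E (N + 1)) (s : (Fin d → ℤ) → ℤˣ) (m : Fin d → ℤ)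
    (x : E (N + 1)) : E (N + 1) := reflLast (s m) x + lat m

lemma baseRel_iff {p q : E (N + 1)} : BaseRel lat s p q ↔ ∃ m, p = act lat s m q := by
  constructor
  · rintro ⟨m, z, rfl, rfl⟩
    exact ⟨m, by rw [act, reflLast_self]⟩
  · rintro ⟨m, rfl⟩
    exact ⟨m, reflLast (s m) q, rfl, (reflLast_self _ _).symm⟩

/-- The identifications are closed under inversion. -/
lemma IsTwistedLattice.exists_perm_inv (h : IsTwistedLattice lat s χ) :
    ∃ τ : Equiv.Perm (Fin d → ℤ), (∀ m x, act lat s (τ m) (act lat s m x) = x) ∧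
      (∀ m x, act lat s m (act lat s (τ m) x) = x) ∧
      ∀ m x, ‖act lat s m x‖ = ‖x - lat (τ m)‖ := by
  obtain ⟨τ, hinv, hτ⟩ := h.exists_perm_flip
  have hl : ∀ m x, act lat s (τ m) (act lat s m x) = x := fun m x => by
    rw [act, act, (hτ m).2.1, reflLast_add, reflLast_self, (hτ m).1, neg_add_cancel_right]
  refine ⟨τ, hl, fun m x => ?_, fun m x => ?_⟩
  · simpa only [hinv m] using hl (τ m) x
  · rw [← norm_reflLast (s m) (act lat s m x), act, reflLast_add, reflLast_self, (hτ m).1,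
      sub_eq_add_neg]

/-- The identifications are closed under composition when the sign rule is multiplicative. -/
lemma IsTwistedLattice.act_comp (h : IsTwistedLattice lat s χ)
    (hs : ∀ m m', s (m + m') = s m * s m') (m' m : Fin d → ℤ) :
    ∃ m'', (∀ x, act lat s m' (act lat s m x) = act lat s m'' x) ∧ s m'' = s m' * s m ∧
      lat m'' = reflLast (s m') (lat m) + lat m' := by
  obtain ⟨n, hn, hsn, -⟩ := h.exists_reflLast (s m') m
  have h1 : s (n + m') = s m' * s m := by rw [hs, hsn, mul_comm]
  have h2 : lat (n + m') = reflLast (s m') (lat m) + lat m' := by rw [h.lat_add, hn]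
  refine ⟨n + m', fun x => ?_, h1, h2⟩
  rw [act, act, act, h1, h2, reflLast_add, reflLast_reflLast, add_assoc]

/-- For a multiplicative sign rule, the identifications form a group, so that the classes are its
orbits. -/
lemma IsTwistedLattice.mk_eq_mk_iff (h : IsTwistedLattice lat s χ)
    (hs : ∀ m m', s (m + m') = s m * s m') {x y : E (N + 1)} :
    (Quot.mk _ y : Base lat s) = Quot.mk _ x ↔ ∃ m, y = act lat s m x := by
  obtain ⟨τ, hτ1, hτ2, -⟩ := h.exists_perm_inv
  have heq : Equivalence (BaseRel lat s) := by
    refine ⟨fun x => ?_, fun {x y} hxy => ?_, fun {x y z} hxy hyz => ?_⟩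
    · refine baseRel_iff.2 ⟨0, ?_⟩
      have h0 : s 0 = 1 := by
        have := hs 0 0
        rw [add_zero, Int.units_mul_self] at this
        exact this
      rw [act, h0, h.lat_zero, reflLast_one, add_zero]
    · obtain ⟨m, rfl⟩ := baseRel_iff.1 hxy
      exact baseRel_iff.2 ⟨τ m, (hτ1 m y).symm⟩
    · obtain ⟨m, rfl⟩ := baseRel_iff.1 hxy
      obtain ⟨m', rfl⟩ := baseRel_iff.1 hyz
      obtain ⟨m'', hm'', -⟩ := h.act_comp hs m m'
      exact baseRel_iff.2 ⟨m'', hm'' z⟩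
  rw [heq.quot_mk_eq_iff, baseRel_iff]

/-- Almost every point has pairwise different distances to the lattice points. In particular its
stabilizer is trivial, although single points may have a nontrivial one. -/
lemma IsTwistedLattice.ae_injective_norm_sub (h : IsTwistedLattice lat s χ) :
    ∀ᵐ x : E (N + 1), Function.Injective fun m => ‖x - lat m‖ := by
  have h1 : ∀ᵐ x : E (N + 1), ∀ m m', m ≠ m' → ‖x - lat m‖ ≠ ‖x - lat m'‖ := by
    rw [ae_all_iff]; intro m
    rw [ae_all_iff]; intro m'
    by_cases hmm : m = m'
    · simp [hmm]
    · have hne : AffineSubspace.perpBisector (lat m) (lat m') ≠ ⊤ := by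
        rw [Ne, AffineSubspace.perpBisector_eq_top]
        exact fun h2 => hmm (h.lat_injective h2)
      have h2 := Measure.addHaar_affineSubspace (volume : Measure (E (N + 1))) _ hne
      filter_upwards [measure_eq_zero_iff_ae_notMem.1 h2] with x hx _ hx'
      refine hx (AffineSubspace.mem_perpBisector_iff_dist_eq.2 ?_)
      rw [dist_eq_norm, dist_eq_norm, hx']
  filter_upwards [h1] with x hx m m' hmm
  by_contra hne
  exact hx m m' hne hmm

lemma IsTwistedLattice.ae_injective_norm_act (h : IsTwistedLattice lat s χ) :
    ∀ᵐ x : E (N + 1), Function.Injective fun m => ‖act lat s m x‖ := by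
  obtain ⟨τ, -, -, hτ⟩ := h.exists_perm_inv
  filter_upwards [h.ae_injective_norm_sub] with x hx
  simp_rw [hτ]
  exact hx.comp τ.injective

lemma continuous_act (m : Fin d → ℤ) : Continuous (act lat s m) :=
  (reflIso (s m)).continuous.add continuous_const

/-- The open Voronoi cell of the origin with respect to the lattice is a fundamental domain. -/
lemma IsTwistedLattice.exists_isFundDomain (h : IsTwistedLattice lat s χ)
    (hs : ∀ m m', s (m + m') = s m * s m') : ∃ F, IsFundDomain lat s F := by
  obtain ⟨τ, hτ1, hτ2, hτn⟩ := h.exists_perm_inv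
  refine ⟨⋂ m : Fin d → ℤ, ⋂ _ : m ≠ 0, {x | ‖x‖ < ‖act lat s m x‖},
    MeasurableSet.iInter fun m => MeasurableSet.iInter fun _ =>
      (isOpen_lt continuous_norm (continuous_act m).norm).measurableSet, ?_⟩
  filter_upwards [h.ae_injective_norm_act] with x hx
  -- an orbit point of minimal norm
  obtain ⟨m, hm⟩ : ∃ m, ∀ m', ‖act lat s m x‖ ≤ ‖act lat s m' x‖ := by
    have hfin : {m | ‖act lat s m x‖ ≤ ‖act lat s 0 x‖}.Finite := by
      have h1 := h.eventually_le_norm (‖x‖ + ‖act lat s 0 x‖ + 1)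
      have h2 : ∀ᶠ m in Filter.cofinite, ¬ ‖act lat s m x‖ ≤ ‖act lat s 0 x‖ := by
        filter_upwards [τ.injective.tendsto_cofinite.eventually h1] with m hm
        rw [hτn m]
        have := norm_sub_norm_le (lat (τ m)) x
        rw [norm_sub_rev] at this
        linarith
      simpa using Filter.eventually_cofinite.1 h2
    obtain ⟨m, hm, hmin⟩ := Set.exists_min_image _ (fun m => ‖act lat s m x‖) hfin
      ⟨0, le_refl ‖act lat s 0 x‖⟩
    refine ⟨m, fun m' => ?_⟩
    rcases le_or_gt ‖act lat s m' x‖ ‖act lat s 0 x‖ with h3 | h3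
    · exact hmin m' h3
    · exact hm.trans h3.le
  refine ⟨act lat s m x, ⟨?_, (h.mk_eq_mk_iff hs).2 ⟨m, rfl⟩⟩, ?_⟩
  · simp only [Set.mem_iInter, Set.mem_ofPred_eq]
    intro m' hm'
    obtain ⟨m'', hc, hsm, hl⟩ := h.act_comp hs m' m
    rw [hc]
    refine lt_of_le_of_ne (hm m'') fun heq => hm' ?_
    have h1 : m = m'' := hx heq
    rw [← h1] at hsm hl
    have h2 : s m' = 1 := by simpa using hsm
    rw [h2, reflLast_one, left_eq_add, ← h.lat_zero] at hl
    exact h.lat_injective hl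
  · rintro y ⟨hy, hyx⟩
    obtain ⟨m', rfl⟩ := (h.mk_eq_mk_iff hs).1 hyx
    by_contra hne
    have hmm : m' ≠ m := fun h1 => hne (by rw [h1])
    obtain ⟨n, hn⟩ := (h.mk_eq_mk_iff hs).1 (show (Quot.mk _ (act lat s m x) : Base lat s) =
      Quot.mk _ (act lat s m' x) from ((h.mk_eq_mk_iff hs).2 ⟨m, rfl⟩).trans
        ((h.mk_eq_mk_iff hs).2 ⟨m', rfl⟩).symm)
    simp only [Set.mem_iInter, Set.mem_ofPred_eq] at hy
    have hn0 : n ≠ 0 := fun h0 => by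
      have hs0 : s 0 = 1 := by
        have := hs 0 0
        rw [add_zero, Int.units_mul_self] at this
        exact this
      rw [h0, act, act, hs0, h.lat_zero, reflLast_one, add_zero] at hn
      exact hne hn.symm
    have h3 := hy n hn0
    rw [← hn] at h3
    exact absurd (hm m') (not_le.2 h3)

/-- The action on space-time that is trivial in time. -/
def actST (lat : (Fin d → ℤ) → E (N + 1)) (s : (Fin d → ℤ) → ℤˣ) (m : Fin d → ℤ)
    (p : SpaceTime (N + 1)) : SpaceTime (N + 1) := (act lat s m p.1, p.2)

lemma measurableEmbedding_actST (m : Fin d → ℤ) : MeasurableEmbedding (actST lat s m) :=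
  (((reflIso (s m)).toHomeomorph.trans (Homeomorph.addRight (lat m))).prodCongr
    (Homeomorph.refl ℝ)).measurableEmbedding

lemma measurePreserving_actST (m : Fin d → ℤ) :
    MeasurePreserving (actST lat s m) volume volume :=
  ((measurePreserving_add_right volume (lat m)).comp
    (reflIso (s m)).measurePreserving).prod (MeasurePreserving.id volume)

/-- Unfolding: the integral over the quotient of the sum over the orbits is the integral over the
covering space. -/
lemma IsTwistedLattice.unfold (h : IsTwistedLattice lat s χ)
    (hs : ∀ m m', s (m + m') = s m * s m') {F : Set (E (N + 1))} (hF : IsFundDomain lat s F)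
    {g : SpaceTime (N + 1) → ℂ} (hg : Integrable g) :
    IntegrableOn (fun p => ∑' m, g (actST lat s m p)) (F ×ˢ Set.univ) ∧
      ∫ p in F ×ˢ Set.univ, ∑' m, g (actST lat s m p) = ∫ p, g p := by
  obtain ⟨τ, hτ1, hτ2, -⟩ := h.exists_perm_inv
  obtain ⟨hFm, hFu⟩ := hF
  -- the translates of the fundamental domain tile space-time up to null sets
  set B : (Fin d → ℤ) → Set (SpaceTime (N + 1)) := fun m => {p | act lat s (τ m) p.1 ∈ F} with hB
  have hBm : ∀ m, MeasurableSet (B m) := fun m =>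
    (hFm.preimage (continuous_act (τ m)).measurable).preimage measurable_fst
  have hpre : ∀ m, actST lat s m ⁻¹' B m = F ×ˢ Set.univ := fun m => by
    ext p
    simp [hB, actST, hτ1]
  have hgen : ∀ᵐ p : SpaceTime (N + 1), (∃! y, y ∈ F ∧ (Quot.mk _ y : Base lat s) = Quot.mk _ p.1) ∧
      Function.Injective fun m => ‖act lat s m p.1‖ :=
    (Measure.quasiMeasurePreserving_fst (μ := (volume : Measure (E (N + 1))))
      (ν := (volume : Measure ℝ))).ae (hFu.and h.ae_injective_norm_act)
  have hdisj : Pairwise (Function.onFun (AEDisjoint volume) B) := by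
    intro m m' hmm
    refine measure_mono_null ?_ (ae_iff.1 hgen)
    rintro p ⟨hp1, hp2⟩ ⟨⟨y, -, hy⟩, hinj⟩
    have e1 := hy _ ⟨hp1, (h.mk_eq_mk_iff hs).2 ⟨τ m, rfl⟩⟩
    have e2 := hy _ ⟨hp2, (h.mk_eq_mk_iff hs).2 ⟨τ m', rfl⟩⟩
    refine hmm (τ.injective (hinj ?_))
    simp only
    rw [e1, e2]
  have hcover : (⋃ m, B m) =ᵐ[volume] Set.univ := by
    rw [Filter.eventuallyEq_univ]
    filter_upwards [hgen] with p hp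
    obtain ⟨y, ⟨hyF, hyp⟩, -⟩ := hp.1
    obtain ⟨n, rfl⟩ := (h.mk_eq_mk_iff hs).1 hyp
    refine Set.mem_iUnion.2 ⟨τ.symm n, ?_⟩
    simpa [hB] using hyF
  have hset : ∀ {G : Type} [NormedAddCommGroup G] [NormedSpace ℝ G] (g : SpaceTime (N + 1) → G) m,
      ∫ p in F ×ˢ Set.univ, g (actST lat s m p) = ∫ p in B m, g p := fun g m => by
    rw [← hpre m]
    exact (measurePreserving_actST m).setIntegral_preimage_emb (measurableEmbedding_actST m) g (B m)
  have hsum := hasSum_integral_iUnion_ae (fun m => (hBm m).nullMeasurableSet) hdisj hg.integrableOn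
  have hsumn := hasSum_integral_iUnion_ae (fun m => (hBm m).nullMeasurableSet) hdisj
    hg.norm.integrableOn
  rw [setIntegral_congr_set hcover, setIntegral_univ] at hsum
  simp_rw [← hset] at hsum hsumn
  have hint : ∀ m, IntegrableOn (fun p => g (actST lat s m p)) (F ×ˢ Set.univ) := fun m =>
    ((measurePreserving_actST m).integrable_comp_of_integrable hg).integrableOn
  refine ⟨integrable_tsum_of_summable_integral_norm hint hsumn.summable, ?_⟩
  exact (hasSum_integral_of_summable_integral_norm hint hsumn.summable).unique hsum

end Action

/-! ### Equivariant test functions -/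

section Equivariant

variable {N d : ℕ} {lat : (Fin d → ℤ) → E (N + 1)} {s χ : (Fin d → ℤ) → ℤˣ} {ε : ℝ}

/-- The linear part of the action on space-time. -/
def reflIsoST (σ : ℤˣ) : SpaceTime (N + 1) ≃ₗᵢ[ℝ] SpaceTime (N + 1) where
  toLinearEquiv := (reflIso σ).toLinearEquiv.prodCongr (LinearEquiv.refl ℝ ℝ)
  norm_map' p := by
    change ‖((reflIso σ p.1, p.2) : SpaceTime (N + 1))‖ = ‖p‖
    rw [Prod.norm_def, Prod.norm_def, (reflIso σ).norm_map]

lemma actST_eq (m : Fin d → ℤ) (p : SpaceTime (N + 1)) :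
    actST lat s m p = reflIsoST (s m) p + (lat m, 0) := by
  ext
  · rfl
  · change p.2 = p.2 + 0
    rw [add_zero]

lemma norm_iteratedFDeriv_comp_actST (f : SpaceTime (N + 1) → ℂ) (m : Fin d → ℤ) (k : ℕ)
    (p : SpaceTime (N + 1)) :
    ‖iteratedFDeriv ℝ k (fun q => f (actST lat s m q)) p‖ =
      ‖iteratedFDeriv ℝ k f (actST lat s m p)‖ := by
  have h1 : (fun q => f (actST lat s m q)) =
      (fun q => f (q + (lat m, 0))) ∘ reflIsoST (s m) := funext fun q => by
    rw [actST_eq]; rfl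
  rw [h1, LinearIsometryEquiv.norm_iteratedFDeriv_comp_right, iteratedFDeriv_comp_add_right,
    actST_eq]

lemma dist_actST (m : Fin d → ℤ) (p q : SpaceTime (N + 1)) :
    dist (actST lat s m p) (actST lat s m q) = dist p q := by
  rw [actST_eq, actST_eq, dist_add_right, LinearIsometryEquiv.dist_map]

lemma laplacian_comp_act {f : E (N + 1) → ℂ} (hf : ContDiff ℝ 2 f) (m : Fin d → ℤ)
    (x : E (N + 1)) :
    Laplacian.laplacian (fun y => f (act lat s m y)) x = Laplacian.laplacian f (act lat s m x) := by
  set b := EuclideanSpace.basisFun (Fin (N + 1)) ℝ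
  set R := (reflIso (N := N) (s m))
  rw [InnerProductSpace.laplacian_eq_iteratedFDeriv_orthonormalBasis _ b,
    InnerProductSpace.laplacian_eq_iteratedFDeriv_orthonormalBasis f (b.map R)]
  refine Finset.sum_congr rfl fun i _ => ?_
  have h1 : (fun y => f (act lat s m y)) =
      (fun y => f (y + lat m)) ∘ (R.toContinuousLinearEquiv : E (N + 1) →L[ℝ] E (N + 1)) := rfl
  have hg : ContDiff ℝ 2 fun y : E (N + 1) => f (y + lat m) := hf.comp (by fun_prop)
  rw [h1, ContinuousLinearMap.iteratedFDeriv_comp_right _ hg x le_rfl,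
    iteratedFDeriv_comp_add_right, ContinuousMultilinearMap.compContinuousLinearMap_apply]
  have h2 : (R.toContinuousLinearEquiv : E (N + 1) →L[ℝ] E (N + 1)) x + lat m = act lat s m x := rfl
  rw [h2]
  congr 1
  funext j
  fin_cases j <;> rfl

lemma schrodingerOpTranspose_comp_actST {f : SpaceTime (N + 1) → ℂ} (hf : ContDiff ℝ 2 f)
    (m : Fin d → ℤ) (p : SpaceTime (N + 1)) :
    schrodingerOpTranspose ε (fun q => f (actST lat s m q)) p =
      schrodingerOpTranspose ε f (actST lat s m p) := by
  have h1 : ContDiff ℝ 2 fun y : E (N + 1) => f (y, p.2) := hf.comp (by fun_prop)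
  have h2 := laplacian_comp_act (lat := lat) (s := s) h1 m p.1
  simp only [schrodingerOpTranspose, actST]
  rw [h2]

lemma schrodingerOpTranspose_const_mul {n : ℕ} {f : SpaceTime n → ℂ} (hf : ContDiff ℝ 2 f) (c : ℂ)
    (p : SpaceTime n) :
    schrodingerOpTranspose ε (fun p => c * f p) p = c * schrodingerOpTranspose ε f p := by
  have h1 : ContDiff ℝ 2 (fun y : E n => f (y, p.2)) := hf.comp (by fun_prop)
  have h2 : ContDiff ℝ 2 (fun τ : ℝ => f (p.1, τ)) := hf.comp (by fun_prop)
  have h3 := InnerProductSpace.laplacian_smul c (h1.contDiffAt (x := p.1))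
  simp only [schrodingerOpTranspose]
  rw [deriv_const_mul c ((h2.differentiable (by norm_num)) p.2)]
  change Laplacian.laplacian (c • fun y : E n => f (y, p.2)) p.1 + _ = _
  rw [h3, smul_eq_mul]
  ring

/-- Equivariance and compactness of the support modulo the action bound all derivatives. -/
lemma exists_hasBoundedJet {f : SpaceTime (N + 1) → ℂ} (hf : ContDiff ℝ ∞ f)
    (heq : ∀ m p, f (actST lat s m p) = (((χ m : ℤˣ) : ℤ) : ℂ) * f p)
    {K : Set (SpaceTime (N + 1))} (hK : IsCompact K)
    (hsupp : ∀ p, f p ≠ 0 → ∃ m, actST lat s m p ∈ K) : ∃ C, HasBoundedJet f C := by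
  have hinv : ∀ k m p, ‖iteratedFDeriv ℝ k f (actST lat s m p)‖ = ‖iteratedFDeriv ℝ k f p‖ := by
    intro k m p
    rw [← norm_iteratedFDeriv_comp_actST]
    have h1 : (fun q => f (actST lat s m q)) = (((χ m : ℤˣ) : ℤ) : ℂ) • f := funext fun q => heq m q
    rw [h1, iteratedFDeriv_const_smul_apply (hf.of_le (by exact_mod_cast le_top)).contDiffAt,
      norm_smul, norm_units_cast, one_mul]
  have hbd : ∀ k, ∃ C, ∀ p, ‖iteratedFDeriv ℝ k f p‖ ≤ C := by
    intro k
    have hcont : Continuous (iteratedFDeriv ℝ k f) :=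
      hf.continuous_iteratedFDeriv (by exact_mod_cast le_top)
    obtain ⟨C, hC⟩ := (hK.cthickening (r := 1)).exists_bound_of_continuousOn hcont.continuousOn
    refine ⟨max C 0, fun p => ?_⟩
    by_cases hp : iteratedFDeriv ℝ k f p = 0
    · rw [hp, norm_zero]; exact le_max_right _ _
    · have hmem : p ∈ tsupport f := support_iteratedFDeriv_subset k hp
      obtain ⟨q, hq, hpq⟩ := Metric.mem_closure_iff.1 hmem 1 one_pos
      obtain ⟨m, hm⟩ := hsupp q hq
      rw [← hinv k m p]
      refine (hC _ (Metric.mem_cthickening_of_dist_le _ _ _ _ hm ?_)).trans (le_max_left _ _)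
      rw [dist_actST]
      exact hpq.le
  obtain ⟨C0, h0⟩ := hbd 0
  obtain ⟨C1, h1⟩ := hbd 1
  obtain ⟨C2, h2⟩ := hbd 2
  refine ⟨max C0 (max C1 C2), hf.of_le (by norm_cast), fun p => ?_, fun p => ?_, fun p => ?_⟩
  · rw [← norm_iteratedFDeriv_zero (𝕜 := ℝ)]
    exact (h0 p).trans (le_max_left _ _)
  · rw [← norm_iteratedFDeriv_one]
    exact (h1 p).trans ((le_max_left _ _).trans (le_max_right _ _))
  · rw [← norm_iteratedFDeriv_one, norm_iteratedFDeriv_fderiv]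
    exact (h2 p).trans ((le_max_right _ _).trans (le_max_right _ _))

/-- Unfolding turns the integral over the quotient into the pairing of the kernel with the lifted
test function. The latter is not compactly supported, but it has a bounded jet and vanishes at late
times, which is all that the fundamental solution property on Euclidean space requires. -/
theorem IsTwistedLattice.isFundamentalSolutionOnQuotient (h : IsTwistedLattice lat s χ)
    (hs : ∀ m m', s (m + m') = s m * s m') (hε : 0 < ε) :
    IsFundamentalSolutionOnQuotient lat s χ ε := by
  refine ⟨h.exists_isFundDomain hs, fun F hF φ hφ ℓ => ?_⟩
  set f : SpaceTime (N + 1) → ℂ := fun p => ℓ (φ p) with hfdef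
  have hf : ContDiff ℝ ∞ f := hφ.smooth ℓ
  have hf2 : ContDiff ℝ 2 f := hf.of_le (by norm_cast)
  have hχ : ∀ m, (((χ m : ℤˣ) : ℤ) : ℂ) * (((χ m : ℤˣ) : ℤ) : ℂ) = 1 := fun m => by
    rcases Int.units_eq_one_or (χ m) with h1 | h1 <;> simp [h1]
  have heq : ∀ m p, f (actST lat s m p) = (((χ m : ℤˣ) : ℤ) : ℂ) * f p := fun m p => by
    have h1 := hφ.equivariant m (reflLast (s m) p.1) p.2
    rw [reflLast_self] at h1
    have h2 : f p = (((χ m : ℤˣ) : ℤ) : ℂ) * f (actST lat s m p) := by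
      have h3 := congrArg ℓ h1
      rw [map_smul, smul_eq_mul] at h3
      exact h3
    rw [h2, ← mul_assoc, hχ, one_mul]
  obtain ⟨K, hK, hsupp⟩ := hφ.compact_support
  have hne : ∀ p, f p ≠ 0 → φ p ≠ 0 := fun p hp h0 => hp (by rw [hfdef]; simp [h0])
  obtain ⟨C, hC⟩ := exists_hasBoundedJet hf heq hK fun p hp => by
    obtain ⟨y, hyK, hy⟩ := hsupp p.1 p.2 (hne p hp)
    obtain ⟨m, rfl⟩ := (h.mk_eq_mk_iff hs).1 hy
    exact ⟨m, hyK⟩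
  obtain ⟨T, hT⟩ := hK.isBounded.exists_norm_le
  have hlate : ∀ x t, T < t → f (x, t) = 0 := fun x t ht => by
    by_contra hp
    obtain ⟨y, hyK, -⟩ := hsupp x t (hne (x, t) hp)
    have := (norm_snd_le (y, t)).trans (hT _ hyK)
    exact absurd ((le_abs_self t).trans this) (not_le.2 ht)
  have hint := integrable_eMinus_mul hε hC hlate
  have hval := integral_eMinus_mul_schrodingerOpTranspose hε hC hlate
  have hop : ∀ m p, schrodingerOpTranspose ε f (actST lat s m p) =
      (((χ m : ℤˣ) : ℤ) : ℂ) * schrodingerOpTranspose ε f p := fun m p => by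
    rw [← schrodingerOpTranspose_comp_actST hf2, ← schrodingerOpTranspose_const_mul hf2]
    simp_rw [heq m]
  have hsum : ∀ p, ∑' m, eMinus ε (actST lat s m p) *
      schrodingerOpTranspose ε f (actST lat s m p) =
      twistedSeries lat s χ ε p * schrodingerOpTranspose ε f p := fun p => by
    rw [twistedSeries, ← tsum_mul_right]
    refine tsum_congr fun m => ?_
    rw [hop, seriesTerm, actST, act]
    ring
  have hunf := h.unfold hs hF hint
  simp_rw [hsum] at hunf
  rw [hval] at hunf
  exact hunf

end Equivariant

/-! ### Möbius strips and Klein bottles -/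

section Parity

variable {d : ℕ}

lemma paritySign_add (S : Finset (Fin d)) (m m' : Fin d → ℤ) :
    paritySign S (m + m') = paritySign S m * paritySign S m' := by
  simp only [paritySign, Pi.add_apply, Finset.sum_add_distrib, zpow_add]

lemma paritySign_neg (S : Finset (Fin d)) (m : Fin d → ℤ) :
    paritySign S (-m) = paritySign S m := by
  simp only [paritySign, Pi.neg_apply, Finset.sum_neg_distrib, zpow_neg, Int.units_inv_eq_self]

lemma paritySign_update_neg (S : Finset (Fin d)) (m : Fin d → ℤ) (i : Fin d) :
    paritySign S (Function.update m i (-m i)) = paritySign S m := by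
  have h : Function.update m i (-m i) = m + (Pi.single i (-m i) + Pi.single i (-m i)) := by
    funext j
    by_cases hj : j = i
    · subst hj
      simp
    · simp [hj]
  rw [h, paritySign_add, paritySign_add, Int.units_mul_self, mul_one]

end Parity

section ZeroExtend

variable {k : ℕ}

/-- `zeroExtend` as a linear map. -/
def zeroExtendₗ (n : ℕ) : E k →ₗ[ℝ] E n where
  toFun := zeroExtend n
  map_add' x y := by
    ext i
    simp only [zeroExtend, PiLp.add_apply]
    split_ifs <;> simp
  map_smul' c x := by
    ext i
    simp only [zeroExtend, PiLp.smul_apply, RingHom.id_apply]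
    split_ifs <;> simp

lemma zeroExtendₗ_injective {n : ℕ} (hk : k ≤ n) :
    Function.Injective (zeroExtendₗ n : E k →ₗ[ℝ] E n) := by
  intro x y hxy
  ext i
  have h := congrArg (fun z : E n => z ⟨i, i.2.trans_le hk⟩) hxy
  simpa [zeroExtendₗ, zeroExtend] using h

lemma zeroExtend_last {N : ℕ} (hk : k ≤ N) (y : E k) :
    zeroExtend (N + 1) y (Fin.last N) = 0 := by
  simp [zeroExtend, hk]

lemma zeroExtend_latticeVec (n : ℕ) (v : Fin k → E k) (m : Fin k → ℤ) :
    zeroExtend n (latticeVec v m) = ∑ i, m i • zeroExtend n (v i) := by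
  change zeroExtendₗ n (∑ i, m i • v i) = ∑ i, m i • zeroExtendₗ n (v i)
  simp only [map_sum, map_zsmul]

lemma linearIndependent_zeroExtend {n : ℕ} (hk : k ≤ n) {v : Fin k → E k}
    (hv : LinearIndependent ℝ v) : LinearIndependent ℝ fun i => zeroExtend n (v i) :=
  hv.map' (zeroExtendₗ n) (LinearMap.ker_eq_bot.2 (zeroExtendₗ_injective hk))

lemma reflLast_of_last_eq_zero {N : ℕ} (σ : ℤˣ) {x : E (N + 1)} (hx : x (Fin.last N) = 0) :
    reflLast σ x = x := by
  ext i
  simp only [reflLast]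
  split_ifs with h
  · rw [h, hx, mul_zero]
  · rfl

end ZeroExtend

section Moebius

variable {N k : ℕ} {v : Fin k → E k}

lemma latticeVec_neg (m : Fin k → ℤ) : latticeVec v (-m) = -latticeVec v m := by
  simp [latticeVec]

lemma latticeSgn_neg (m : Fin k → ℤ) : latticeSgn v (-m) = latticeSgn v m := by
  have h : (∃ m', latticeVec v (-m) = (2 : ℤ) • latticeVec v m') ↔
      ∃ m', latticeVec v m = (2 : ℤ) • latticeVec v m' := by
    rw [← (Equiv.neg (Fin k → ℤ)).exists_congr_right]
    simp only [Equiv.neg_apply, latticeVec_neg, smul_neg, neg_inj]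
  unfold latticeSgn
  congr 1
  exact propext h

/-- The reflection fixes the lattice of a Möbius strip pointwise. -/
lemma isTwistedLattice_moebiusLat (hk : k ≤ N) (hv : LinearIndependent ℝ v)
    {s : (Fin k → ℤ) → ℤˣ} (hs : ∀ m, s (-m) = s m) (S : Finset (Fin k)) :
    IsTwistedLattice (moebiusLat N v) s (paritySign S) where
  exists_basis := ⟨fun i => zeroExtend (N + 1) (v i),
    linearIndependent_zeroExtend (hk.trans N.le_succ) hv, zeroExtend_latticeVec _ v⟩
  parity_add := paritySign_add S
  sign_neg := hs
  exists_refl m := ⟨m, reflLast_of_last_eq_zero _ (zeroExtend_last hk _), rfl, rfl⟩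

/-- In rank one, membership in `2Ω` is the parity of the single coefficient. -/
lemma latticeSgn_eq_paritySign {v : Fin 1 → E 1} (hv : LinearIndependent ℝ v) :
    latticeSgn v = paritySign Finset.univ := by
  funext m
  have h : (∃ m', latticeVec v m = (2 : ℤ) • latticeVec v m') ↔ Even (m 0) := by
    simp only [latticeVec, Fin.sum_univ_one, smul_smul]
    have hinj : Function.Injective fun a : ℤ => a • v 0 := by
      intro a b hab
      have h0 : ((a : ℝ)) • v 0 = (b : ℝ) • v 0 := by
        simpa only [Int.cast_smul_eq_zsmul] using hab
      exact_mod_cast smul_left_injective ℝ (hv.ne_zero 0) h0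
    constructor
    · rintro ⟨m', hm'⟩
      exact ⟨m' 0, by rw [hinj hm', two_mul]⟩
    · rintro ⟨a, ha⟩
      exact ⟨fun _ => a, by rw [ha, two_mul]⟩
  simp only [latticeSgn, h, paritySign, Fin.sum_univ_one]
  split_ifs with he
  · rw [he.neg_one_zpow]
  · rw [(Int.not_even_iff_odd.1 he).neg_one_zpow]

end Moebius

section Klein

variable {N : ℕ} {v : Fin N → E N}

lemma linearIndependent_snoc_zeroExtend (hv : LinearIndependent ℝ v) :
    LinearIndependent ℝ (Fin.snoc (fun i => zeroExtend (N + 1) (v i))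
      (EuclideanSpace.single (Fin.last N) (1 : ℝ)) : Fin (N + 1) → E (N + 1)) := by
  rw [linearIndependent_finSnoc]
  refine ⟨linearIndependent_zeroExtend N.le_succ hv, fun h => ?_⟩
  have h0 : Submodule.span ℝ (Set.range fun i => zeroExtend (N + 1) (v i)) ≤
      LinearMap.ker (EuclideanSpace.projₗ (𝕜 := ℝ) (Fin.last N) : E (N + 1) →ₗ[ℝ] ℝ) := by
    rw [Submodule.span_le]
    rintro _ ⟨i, rfl⟩
    exact zeroExtend_last le_rfl _
  have h1 := h0 h
  simp at h1

lemma reflLast_neg_one_kleinLat (m : Fin (N + 1) → ℤ) :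
    reflLast (-1) (kleinLat v m) =
      kleinLat v (Function.update m (Fin.last N) (-m (Fin.last N))) := by
  have h0 (i : Fin N) : Function.update m (Fin.last N) (-m (Fin.last N)) i.castSucc =
      m i.castSucc := Function.update_of_ne (Fin.castSucc_lt_last i).ne _ _
  ext i
  simp only [kleinLat, h0, Function.update_self, reflLast, PiLp.add_apply]
  split_ifs with h
  · subst h
    simp [zeroExtend_last le_rfl]
  · simp [h]

/-- The reflection inverts the last generator of the lattice of a Klein bottle. -/
lemma isTwistedLattice_kleinLat (hv : LinearIndependent ℝ v) (T S : Finset (Fin (N + 1))) :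
    IsTwistedLattice (kleinLat v) (paritySign T) (paritySign S) where
  exists_basis := ⟨_, linearIndependent_snoc_zeroExtend hv, fun m => by
    rw [Fin.sum_univ_castSucc]
    simp only [Fin.snoc_castSucc, Fin.snoc_last, kleinLat, zeroExtend_latticeVec]⟩
  parity_add := paritySign_add S
  sign_neg := paritySign_neg T
  exists_refl m := ⟨_, reflLast_neg_one_kleinLat m, paritySign_update_neg T m _,
    paritySign_update_neg S m _⟩

end Klein

end PinQuotient

end

theorem mainTheorem10 (N : ℕ) (hN : 1 ≤ N) (ε : ℝ) (hε : 0 < ε) :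
    -- Möbius strips in dimension `n = N + 1`
    (∀ (k : ℕ), 1 ≤ k → k ≤ N →
      ∀ v : Fin k → PinQuotient.E k, LinearIndependent ℝ v → ∀ S : Finset (Fin k),
        -- the reflection follows `sgn`
        PinQuotient.IsPeriodizedFundamentalSolution (PinQuotient.moebiusLat N v)
          (PinQuotient.latticeSgn v) (PinQuotient.paritySign S) ε ∧
        (k = 1 → PinQuotient.IsFundamentalSolutionOnQuotient (PinQuotient.moebiusLat N v)
          (PinQuotient.latticeSgn v) (PinQuotient.paritySign S) ε) ∧
        -- the reflection follows the parity of `m₁ + ⋯ + m_k`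
        PinQuotient.IsPeriodizedFundamentalSolution (PinQuotient.moebiusLat N v)
          (PinQuotient.paritySign Finset.univ) (PinQuotient.paritySign S) ε ∧
        PinQuotient.IsFundamentalSolutionOnQuotient (PinQuotient.moebiusLat N v)
          (PinQuotient.paritySign Finset.univ) (PinQuotient.paritySign S) ε) ∧
    -- Klein bottles in dimension `n = N + 1`
    (∀ v : Fin N → PinQuotient.E N, LinearIndependent ℝ v → ∀ S : Finset (Fin (N + 1)),
        -- the reflection follows the parity of `mₙ`
        PinQuotient.IsPeriodizedFundamentalSolution (PinQuotient.kleinLat v)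
          (PinQuotient.paritySign {Fin.last N}) (PinQuotient.paritySign S) ε ∧
        PinQuotient.IsFundamentalSolutionOnQuotient (PinQuotient.kleinLat v)
          (PinQuotient.paritySign {Fin.last N}) (PinQuotient.paritySign S) ε ∧
        -- the reflection follows the parity of `m₁ + ⋯ + m_{n-1}`
        PinQuotient.IsPeriodizedFundamentalSolution (PinQuotient.kleinLat v)
          (PinQuotient.paritySign (Finset.univ.erase (Fin.last N))) (PinQuotient.paritySign S) ε ∧
        PinQuotient.IsFundamentalSolutionOnQuotient (PinQuotient.kleinLat v)
          (PinQuotient.paritySign (Finset.univ.erase (Fin.last N))) (PinQuotient.paritySign S) ε)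
    := by
  refine ⟨fun k _ hk v hv S => ?_, fun v hv S => ?_⟩
  · have hsgn := PinQuotient.isTwistedLattice_moebiusLat hk hv
      (PinQuotient.latticeSgn_neg (v := v)) S
    have hpar := PinQuotient.isTwistedLattice_moebiusLat hk hv
      (PinQuotient.paritySign_neg Finset.univ) S
    refine ⟨hsgn.isPeriodizedFundamentalSolution hε, ?_, hpar.isPeriodizedFundamentalSolution hε,
      hpar.isFundamentalSolutionOnQuotient (PinQuotient.paritySign_add _) hε⟩
    rintro rfl
    rw [PinQuotient.latticeSgn_eq_paritySign hv]
    exact hpar.isFundamentalSolutionOnQuotient (PinQuotient.paritySign_add _) hε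
  · have h (T : Finset (Fin (N + 1))) := PinQuotient.isTwistedLattice_kleinLat hv T S
    exact ⟨(h _).isPeriodizedFundamentalSolution hε,
      (h _).isFundamentalSolutionOnQuotient (PinQuotient.paritySign_add _) hε,
      (h _).isPeriodizedFundamentalSolution hε,
      (h _).isFundamentalSolutionOnQuotient (PinQuotient.paritySign_add _) hε⟩
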